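/- Let $\mathbb{CP}^2$ carry its standard complex structure $J$ and its standard (flat) complex projective structure, i.e. the class of the Levi-Civita connection of the Fubini–Study metric under the relation that identifies two torsion-free complex-linear connections with the same generalised geodesics. (A generalised geodesic of $\nabla$ is a smoothly immersed curve $\gamma$ with $\nabla_{\dot\gamma}\dot\gamma\wedge\dot\gamma\wedge J\dot\gamma=0$.) A (pseudo-)Kähler metric on an open set $U$ is a smooth, symmetric, nondegenerate, $J$-invariant bilinear form of any signature on $TU$ whose Levi-Civita connection satisfies $\nabla J=0$; it is called compatible if its Levi-Civita connection belongs to the standard complex projective structure on $U$. For a hermitian $3\times 3$ matrix $C$ and $v\in\mathbb{C}^3\setminus\{0\}$ put $\Delta_C(v)=v^*\operatorname{adj}(C)\,v\in\mathbb{R}$ and $D_C=\{[v]\in\mathbb{CP}^2 : \Delta_C(v)\neq 0\}$. On $D_C$ let $g_C$ be the bilinear form $$ g_C|_{[v]}\big(d\pi_v(w),d\pi_v(w')\big)=\operatorname{Re}\,\frac{-(v\times w)^{t}\,C\,\overline{(v\times w')}}{\Delta_C(v)^2},\qquad w,w'\in\mathbb{C}^3, $$ where $\pi:\mathbb{C}^3\setminus\{0\}\to\mathbb{CP}^2$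 is the projection and $\times$ is the complex bilinear cross product. Let $U\subset\mathbb{CP}^2$ be a domain (a nonempty connected open set). Then $C\mapsto g_C|_U$ is a one-to-one correspondence between the hermitian forms $C$ on $\mathbb{C}^3$ of rank at least two with $U\subset D_C$ and the (pseudo-)Kähler metrics on $U$ that are compatible with the standard complex projective structure. That is: 1. if $C$ is hermitian of rank at least two and $U\subset D_C$, then $g_C$ is a compatible (pseudo-)Kähler metric on $U$; 2. for every compatible (pseudo-)Kähler metric $g$ on $U$ there is exactly one hermitian $C$ of rank at least two such that $U\subset D_C$ and $g=g_C$ on $U$. Moreover, every hermitian form of rank at least two occurs on some domain: 3. if $C$ is hermitian of rank at least two, there is a domain $V\subset U\cap D_C$. -/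

import Mathlib

open scoped Manifold ContDiff Matrix LinearAlgebra.Projectivization

noncomputable section

namespace CProj

/-! ### The complex projective plane as a complex manifold -/

/-- The coordinate space `ℂ²`. -/
abbrev C2 : Type := Fin 2 → ℂ

/-- The space `ℂ³` of homogeneous coordinates. -/
abbrev C3 : Type := Fin 3 → ℂ

/-- The complex projective plane: the complex lines through the origin of `ℂ³`. -/
abbrev CP2 : Type := ℙ ℂ C3

/-- The quotient topology of `ℂ³ ∖ {0}`. -/
instance : TopologicalSpace CP2 :=
  inferInstanceAs (TopologicalSpace (Quotient (projectivizationSetoid ℂ C3)))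

/-- `(z¹, z²) ↦ (z¹, z²)` with a `1` inserted at the `k`-th place. -/
def homog (k : Fin 3) (z : C2) : C3 := k.insertNth (1 : ℂ) z

theorem homog_self (k : Fin 3) (z : C2) : homog k z k = 1 := by
  simp [homog]

theorem homog_succAbove (k : Fin 3) (z : C2) (i : Fin 2) : homog k z (k.succAbove i) = z i := by
  simp [homog]

theorem homog_ne_zero (k : Fin 3) (z : C2) : homog k z ≠ 0 := fun h => by
  simpa [homog_self] using congrFun h k

theorem exists_rep_eq (v : C3) (hv : v ≠ 0) :
    ∃ a : ℂ, a ≠ 0 ∧ (Projectivization.mk ℂ v hv).rep = a • v := by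
  obtain ⟨a, ha⟩ := Projectivization.exists_smul_eq_mk_rep ℂ v hv
  exact ⟨a, a.ne_zero, by rw [← ha]; rfl⟩

theorem isQuotientMap_mk : Topology.IsQuotientMap (Projectivization.mk' ℂ : {v : C3 // v ≠ 0} → CP2) :=
  isQuotientMap_quotient_mk'

theorem isOpen_affine (k : Fin 3) : IsOpen {p : CP2 | p.rep k ≠ 0} := by
  rw [← isQuotientMap_mk.isOpen_preimage]
  have : (Projectivization.mk' ℂ : {v : C3 // v ≠ 0} → CP2) ⁻¹' {p : CP2 | p.rep k ≠ 0}
      = {v | v.1 k ≠ 0} := by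
    ext v
    obtain ⟨a, ha, h⟩ := exists_rep_eq v.1 v.2
    simp [h, ha]
  rw [this]
  exact isOpen_ne.preimage ((continuous_apply k).comp continuous_subtype_val)

/-- The `k`-th affine chart `[v] ↦ (vⁱ / vᵏ)_{i ≠ k}` of `ℂP²`, defined where `vᵏ ≠ 0`; its inverse
is `z ↦ [homog k z]`. -/
def affineChart (k : Fin 3) : OpenPartialHomeomorph CP2 C2 where
  toFun p := fun i => p.rep (k.succAbove i) / p.rep k
  invFun z := Projectivization.mk ℂ (homog k z) (homog_ne_zero k z)
  source := {p | p.rep k ≠ 0}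
  target := Set.univ
  map_source' _ _ := Set.mem_univ _
  map_target' z _ := by
    obtain ⟨a, ha, h⟩ := exists_rep_eq (homog k z) (homog_ne_zero k z)
    simp [h, ha, homog_self]
  left_inv' p hp := by
    have hp' : p.rep k ≠ 0 := hp
    conv_rhs => rw [← p.mk_rep]
    rw [Projectivization.mk_eq_mk_iff']
    refine ⟨(p.rep k)⁻¹, ?_⟩
    ext j
    rcases Fin.eq_self_or_eq_succAbove k j with rfl | ⟨i, rfl⟩
    · simp [homog_self, hp']
    · simp [homog_succAbove, div_eq_inv_mul]
  right_inv' z _ := by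
    obtain ⟨a, ha, h⟩ := exists_rep_eq (homog k z) (homog_ne_zero k z)
    ext i
    simp [h, ha, homog_self, homog_succAbove]
  open_source := isOpen_affine k
  open_target := isOpen_univ
  continuousOn_toFun := by
    rw [isQuotientMap_mk.continuousOn_isOpen_iff (isOpen_affine k)]
    have : ContinuousOn (fun v : {v : C3 // v ≠ 0} => fun i : Fin 2 => v.1 (k.succAbove i) / v.1 k)
        ((Projectivization.mk' ℂ : {v : C3 // v ≠ 0} → CP2) ⁻¹' {p : CP2 | p.rep k ≠ 0}) := by
      refine continuousOn_pi.2 fun i => ContinuousOn.div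
        ((continuous_apply _).comp continuous_subtype_val).continuousOn
        ((continuous_apply _).comp continuous_subtype_val).continuousOn ?_
      intro v hv
      obtain ⟨a, ha, h⟩ := exists_rep_eq v.1 v.2
      simpa [h, ha] using hv
    refine this.congr ?_
    intro v hv
    obtain ⟨a, ha, h⟩ := exists_rep_eq v.1 v.2
    ext i
    simp only [Function.comp, Projectivization.mk'_eq_mk, h, Pi.smul_apply, smul_eq_mul]
    exact mul_div_mul_left _ _ ha
  continuousOn_invFun := by
    refine Continuous.continuousOn ?_
    have h1 : Continuous (fun z : C2 => (⟨homog k z, homog_ne_zero k z⟩ : {v : C3 // v ≠ 0})) := by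
      refine Continuous.subtype_mk ?_ _
      refine continuous_pi fun j => ?_
      rcases Fin.eq_self_or_eq_succAbove k j with rfl | ⟨i, rfl⟩
      · simpa only [homog_self] using continuous_const
      · simpa only [homog_succAbove] using continuous_apply i
    exact isQuotientMap_mk.continuous.comp h1

theorem exists_index (p : CP2) : ∃ k, p.rep k ≠ 0 := by
  by_contra! h
  exact p.rep_nonzero (funext h)

/-- The index of the preferred affine chart around `p`. -/
def index (p : CP2) : Fin 3 := (exists_index p).choose

theorem rep_index_ne_zero (p : CP2) : p.rep (index p) ≠ 0 := (exists_index p).choose_spec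

instance : ChartedSpace C2 CP2 where
  atlas := Set.range affineChart
  chartAt p := affineChart (index p)
  mem_chart_source p := rep_index_ne_zero p
  chart_mem_atlas p := ⟨index p, rfl⟩

theorem contDiffOn_transition (k l : Fin 3) :
    ContDiffOn ℂ ω ((affineChart k).symm ≫ₕ affineChart l)
      ((affineChart k).symm ≫ₕ affineChart l).source := by
  have hh : ∀ j, ContDiff ℂ ω (fun z : C2 => homog k z j) := by
    intro j
    rcases Fin.eq_self_or_eq_succAbove k j with rfl | ⟨i, rfl⟩
    · simpa only [homog_self] using contDiff_const
    · simpa only [homog_succAbove] using contDiff_apply ℂ ℂ i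
  have key : ContDiffOn ℂ ω (fun z : C2 => fun i : Fin 2 => homog k z (l.succAbove i) / homog k z l)
      {z | homog k z l ≠ 0} :=
    contDiffOn_pi.2 fun i => (hh _).contDiffOn.div (hh _).contDiffOn fun z hz => hz
  refine (key.congr ?_).mono ?_
  · intro z _
    obtain ⟨a, ha, h⟩ := exists_rep_eq (homog k z) (homog_ne_zero k z)
    ext i
    change (Projectivization.mk ℂ (homog k z) _).rep _
      / (Projectivization.mk ℂ (homog k z) _).rep _ = _
    rw [h]
    exact mul_div_mul_left _ _ ha
  · intro z hz
    obtain ⟨a, ha, h⟩ := exists_rep_eq (homog k z) (homog_ne_zero k z)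
    have hz' : (Projectivization.mk ℂ (homog k z) (homog_ne_zero k z)).rep l ≠ 0 := hz.2
    rw [h] at hz'
    exact right_ne_zero_of_mul hz'

/-- The affine charts make `ℂP²` a complex manifold. -/
instance : IsManifold 𝓘(ℂ, C2) ω CP2 := by
  refine isManifold_of_contDiffOn _ _ _ ?_
  rintro _ _ ⟨k, rfl⟩ ⟨l, rfl⟩
  simpa using! contDiffOn_transition k l

/-- The underlying smooth real manifold. -/
instance : IsManifold 𝓘(ℝ, C2) ∞ CP2 := by
  refine isManifold_of_contDiffOn _ _ _ ?_
  rintro _ _ ⟨k, rfl⟩ ⟨l, rfl⟩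
  simpa using! ((contDiffOn_transition k l).restrict_scalars ℝ).of_le le_top

/-! ### Hermitian metrics, Levi-Civita connections, generalised geodesics -/

/-- The real tangent space `T_p ℂP²`. In Mathlib it is by definition a copy of the model space `ℂ²`,
the identification being the derivative of the preferred affine chart at `p`. -/
abbrev Tan (p : CP2) : Type := TangentSpace 𝓘(ℝ, C2) p

/-- The complex structure `J` of `ℂP²`. -/
def J {p : CP2} (u : Tan p) : Tan p := (Complex.I • (show C2 from u) : C2)

/-- A field of real bilinear forms on the tangent spaces of `ℂP²`. Only its values over the domain
under consideration matter. -/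
abbrev BilinField : Type := ∀ p : CP2, LinearMap.BilinForm ℝ (Tan p)

/-- The points of `ℂ²` that the inverse of the `k`-th affine chart maps into `U`. -/
def coordDomain (U : Set CP2) (k : Fin 3) : Set C2 := (affineChart k).symm ⁻¹' U

/-- The expression of a field of bilinear forms in the `k`-th affine chart. -/
def BilinField.inChart (g : BilinField) (k : Fin 3) (z u w : C2) : ℝ :=
  g ((affineChart k).symm z)
    (mfderiv 𝓘(ℝ, C2) 𝓘(ℝ, C2) (affineChart k).symm z u)
    (mfderiv 𝓘(ℝ, C2) 𝓘(ℝ, C2) (affineChart k).symm z w)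

/-- An affine connection, given in each affine chart by its Christoffel map `Γ k z : ℂ² × ℂ² → ℂ²`,
so that `∇_u W = D_u W + Γ k z u W` for vector fields `W` in the coordinates of that chart. -/
abbrev Christoffel : Type := Fin 3 → C2 → C2 → C2 → C2

/-- The Levi-Civita connection of `g`: at points where `g` is nondegenerate, `Γ u w` is the unique
vector `a` with
`g(a, y) = (D_u g(w, y) + D_w g(u, y) - D_y g(u, w)) / 2` for all `y`. -/
def leviCivita (g : BilinField) : Christoffel := fun k z u w =>
  Classical.epsilon fun a : C2 => ∀ y : C2, g.inChart k z a y =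
    (fderiv ℝ (fun x => g.inChart k x w y) z u + fderiv ℝ (fun x => g.inChart k x u y) z w
      - fderiv ℝ (fun x => g.inChart k x u w) z y) / 2

/-- The connection is complex-linear on `U`, i.e. `∇J = 0`. -/
def IsComplexLinear (Γ : Christoffel) (U : Set CP2) : Prop :=
  ∀ k, ∀ z ∈ coordDomain U k, ∀ u w : C2, Γ k z u (Complex.I • w) = Complex.I • Γ k z u w

/-- `g` is a (pseudo-)Kähler metric on the open set `U`: a smooth nondegenerate symmetric
`J`-invariant bilinear form, of any signature, whose Levi-Civita connection is complex-linear. -/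
structure IsPseudoKahler (g : BilinField) (U : Set CP2) : Prop where
  smooth : ∀ k, ∀ u w : C2, ContDiffOn ℝ ∞ (fun z => g.inChart k z u w) (coordDomain U k)
  symm : ∀ p ∈ U, ∀ u w : Tan p, g p u w = g p w u
  nondegenerate : ∀ p ∈ U, ∀ u : Tan p, (∀ w : Tan p, g p u w = 0) → u = 0
  hermitian : ∀ p ∈ U, ∀ u w : Tan p, g p (J u) (J w) = g p u w
  parallel : IsComplexLinear (leviCivita g) U

/-- `γ : I → ℂP²` is a generalised geodesic of `Γ`: a smoothly immersed curve whose covariant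
acceleration `∇_γ' γ'` lies in the plane spanned by `γ'` and `Jγ'`, i.e. is a complex multiple
of `γ'`. -/
structure IsGeneralisedGeodesic (Γ : Christoffel) (I : Set ℝ) (γ : ℝ → CP2) : Prop where
  smooth : ContMDiffOn 𝓘(ℝ, ℝ) 𝓘(ℝ, C2) ∞ γ I
  immersed : ∀ t ∈ I, ∀ k, γ t ∈ (affineChart k).source → deriv (affineChart k ∘ γ) t ≠ 0
  planar : ∀ t ∈ I, ∀ k, γ t ∈ (affineChart k).source → ∃ c : ℂ,
    deriv (deriv (affineChart k ∘ γ)) t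
      + Γ k (affineChart k (γ t)) (deriv (affineChart k ∘ γ) t) (deriv (affineChart k ∘ γ) t)
      = c • deriv (affineChart k ∘ γ) t

/-- Two connections are complex projectively equivalent on `U` if they have the same generalised
geodesics in `U`; curves are parametrised by open intervals. -/
def ComplexProjectivelyEquivalent (Γ Γ' : Christoffel) (U : Set CP2) : Prop :=
  ∀ (I : Set ℝ) (γ : ℝ → CP2), IsOpen I → I.OrdConnected → Set.MapsTo γ I U →
    (IsGeneralisedGeodesic Γ I γ ↔ IsGeneralisedGeodesic Γ' I γ)

/-! ### The standard structure and the metrics of hermitian forms -/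

/-- The homogeneous coordinates of `p` normalised in the preferred affine chart. -/
def point (p : CP2) : C3 := homog (index p) (affineChart (index p) p)

/-- `u` with a `0` inserted at the `k`-th place: the derivative of `homog k` in the direction `u`. -/
def direction (k : Fin 3) (u : C2) : C3 := k.insertNth (0 : ℂ) u

theorem direction_add (k : Fin 3) (u w : C2) :
    direction k (u + w) = direction k u + direction k w := by
  ext j
  rcases Fin.eq_self_or_eq_succAbove k j with rfl | ⟨i, rfl⟩ <;> simp [direction]

theorem direction_smul (k : Fin 3) (c : ℝ) (u : C2) :
    direction k (c • u) = (c : ℂ) • direction k u := by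
  ext j
  rcases Fin.eq_self_or_eq_succAbove k j with rfl | ⟨i, rfl⟩ <;> simp [direction]

/-- The representative in `ℂ³` of a tangent vector at `p`: the differential of the projection
`ℂ³ ∖ {0} → ℂP²` at `point p` maps `lift u` to `u`. -/
def lift {p : CP2} (u : Tan p) : C3 := direction (index p) u

theorem lift_add {p : CP2} (u w : Tan p) : lift (u + w) = lift u + lift w :=
  direction_add (index p) u w

theorem lift_smul {p : CP2} (c : ℝ) (u : Tan p) : lift (c • u) = (c : ℂ) • lift u :=
  direction_smul (index p) c u

/-- The standard hermitian product `Σ vⁱ w̄ⁱ` of `ℂ³`. -/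
def herm (v w : C3) : ℂ := v ⬝ᵥ star w

/-- The Fubini–Study metric: the real part of
`(⟨v, v⟩ ⟨w, w'⟩ - ⟨w, v⟩ ⟨v, w'⟩) / ⟨v, v⟩²`
at `[v]` on the tangent vectors represented by `w` and `w'`. -/
def fubiniStudy : BilinField := fun p =>
  LinearMap.mk₂ ℝ
    (fun u u' => ((herm (point p) (point p) * herm (lift u) (lift u')
      - herm (lift u) (point p) * herm (point p) (lift u')) / herm (point p) (point p) ^ 2).re)
    (fun u₁ u₂ w => by
      rw [← Complex.add_re]; congr 1; simp only [herm, lift_add, add_dotProduct]; ring)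
    (fun c u w => by
      rw [smul_eq_mul, ← Complex.re_ofReal_mul]; congr 1
      simp only [herm, lift_smul, smul_dotProduct, smul_eq_mul]; ring)
    (fun u w₁ w₂ => by
      rw [← Complex.add_re]; congr 1; simp only [herm, lift_add, star_add, dotProduct_add]; ring)
    (fun c u w => by
      rw [smul_eq_mul, ← Complex.re_ofReal_mul]; congr 1
      simp only [herm, lift_smul, star_smul, dotProduct_smul, smul_eq_mul, Complex.star_def,
        Complex.conj_ofReal]; ring)

/-- `g` is a (pseudo-)Kähler metric on `U` compatible with the standard complex projective structure,
the class of the Levi-Civita connection of the Fubini–Study metric. -/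
def IsCompatibleMetric (g : BilinField) (U : Set CP2) : Prop :=
  IsPseudoKahler g U ∧ ComplexProjectivelyEquivalent (leviCivita g) (leviCivita fubiniStudy) U

/-- The real number `v* adj(C) v` for a hermitian matrix `C`. -/
def discr (C : Matrix (Fin 3) (Fin 3) ℂ) (v : C3) : ℝ := (star v ⬝ᵥ (C.adjugate *ᵥ v)).re

/-- The set of points `[v]` with `v* adj(C) v ≠ 0`, i.e. where the hermitian form `C` on covectors is
nondegenerate on the annihilator of `v`. -/
def regularSet (C : Matrix (Fin 3) (Fin 3) ℂ) : Set CP2 := {p | discr C (point p) ≠ 0}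

/-- The metric of the hermitian matrix `C`: at `[v]`, on the tangent vectors represented by `w` and
`w'`, it is the real part of
`- (v × w)ᵀ C conj(v × w') / (v* adj(C) v)²`.
For a frame `A = (v, a₁, a₂)` of determinant one and `H = A⁻¹ C (A⁻¹)*`, the hermitian matrix with
the entries `h₁₁ = -H₂₂`, `h₁₂ = H₂₁`, `h₂₁ = H₁₂`, `h₂₂ = -H₁₁` has determinant `v* adj(C) v`, and
this metric has the components `hᵢⱼ / (h₁₁ h₂₂ - |h₁₂|²)²` in the frame represented by `a₁, a₂`. -/
def metricOf (C : Matrix (Fin 3) (Fin 3) ℂ) : BilinField := fun p =>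
  LinearMap.mk₂ ℝ
    (fun u u' => (-((point p ⨯₃ lift u) ⬝ᵥ (C *ᵥ star (point p ⨯₃ lift u')))
      / (discr C (point p) : ℂ) ^ 2).re)
    (fun u₁ u₂ w => by
      rw [← Complex.add_re]; congr 1; simp only [lift_add, map_add, add_dotProduct]; ring)
    (fun c u w => by
      rw [smul_eq_mul, ← Complex.re_ofReal_mul]; congr 1
      simp only [lift_smul, map_smul, smul_dotProduct, smul_eq_mul]; ring)
    (fun u w₁ w₂ => by
      rw [← Complex.add_re]; congr 1
      simp only [lift_add, map_add, star_add, Matrix.mulVec_add, dotProduct_add]; ring)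
    (fun c u w => by
      rw [smul_eq_mul, ← Complex.re_ofReal_mul]; congr 1
      simp only [lift_smul, map_smul, star_smul, Matrix.mulVec_smul, dotProduct_smul, smul_eq_mul,
        Complex.star_def, Complex.conj_ofReal]; ring)

end CProj

end

noncomputable section

namespace CProj

section Charts

/-! ### Affine charts in homogeneous coordinates -/

/-! Write `v = homog k z`, let `u` also denote `direction k u`, and set `Δ = discr C v`, `φ(u) = v*
adj(C) u / Δ`. For the direct statement, the Levi-Civita connection of `metricOf C` in an affine
chart is `Γ(u, w) = -(φ(u) w + φ(w) u)`. This is checked against the Koszul formula, and it rests on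
`discr_mul_hform_cross`, a consequence of `C adj(C) = det C`. Such a `Γ` is complex-linear and has
`Γ(u, u)` a complex multiple of `u`. The Fubini–Study metric is the case `C = -1`, so both
connections add to the acceleration only complex multiples of the velocity and have the same
generalised geodesics.

For the converse, affine lines are generalised geodesics of Fubini–Study, so compatibility forces
`Γ(u, u)` to be a multiple of `u`, and polarisation gives `Γ(u, w) = φ(u) w + φ(w) u` for some
complex-linear `φ` (`exists_linear_form`). Let `h` be the hermitian form of `g`. Along a line with
direction `u`, `h(u, u)` and `det h` have logarithmic derivatives `2(φ(u) + conj φ(u))` and `3(φ(u)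
+ conj φ(u))`. Hence `h(u, u)³ / det(h)²` is constant (`inChart_cube_eq`), and with the real cube
root `r = det(h)^(-1/3)` the form `r² h` takes the same value on `y - z` at `z` and at `y`.

A field of hermitian forms with this property is polynomial of a definite shape
(`ConstOnLines.eq_polynomial`), namely `-(v × u)ᵀ C conj(v × u)` for a constant hermitian `C`.
Comparing determinants yields `Δ = r`, so `g = g_C` locally (`exists_metricOf_eq`). Conversely
`det(g_C) = Δ⁻³`, so `g_C` determines `Δ`, then the numerator, then `C`
(`eq_of_inChart_metricOf_eq`). Local uniqueness makes the local `C` locally constant, hence constant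
on a connected `U`. The rank condition enters because `adj(C) ≠ 0` exactly when the rank is at least
two. -/

theorem direction_self (k : Fin 3) (u : C2) : direction k u k = 0 := by
  simp [direction]

theorem direction_succAbove (k : Fin 3) (u : C2) (i : Fin 2) :
    direction k u (k.succAbove i) = u i := by
  simp [direction]

theorem direction_injective (k : Fin 3) : Function.Injective (direction k) := fun u w h => by
  ext i
  simpa [direction_succAbove] using congrFun h (k.succAbove i)

theorem direction_complex_smul (k : Fin 3) (c : ℂ) (u : C2) :
    direction k (c • u) = c • direction k u := by
  ext j
  rcases Fin.eq_self_or_eq_succAbove k j with rfl | ⟨i, rfl⟩ <;> simp [direction]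

theorem homog_add (k : Fin 3) (z u : C2) : homog k (z + u) = homog k z + direction k u := by
  ext j
  rcases Fin.eq_self_or_eq_succAbove k j with rfl | ⟨i, rfl⟩ <;> simp [homog, direction]

theorem affineChart_mk (l : Fin 3) (v : C3) (hv : v ≠ 0) (i : Fin 2) :
    affineChart l (Projectivization.mk ℂ v hv) i = v (l.succAbove i) / v l := by
  obtain ⟨a, ha, h⟩ := exists_rep_eq v hv
  change (Projectivization.mk ℂ v hv).rep _ / (Projectivization.mk ℂ v hv).rep _ = _
  rw [h]
  exact mul_div_mul_left _ _ ha

theorem mk_mem_source_iff (l : Fin 3) (v : C3) (hv : v ≠ 0) :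
    Projectivization.mk ℂ v hv ∈ (affineChart l).source ↔ v l ≠ 0 := by
  obtain ⟨a, ha, h⟩ := exists_rep_eq v hv
  change (Projectivization.mk ℂ v hv).rep l ≠ 0 ↔ _
  simp [h, ha]

theorem affineChart_symm_apply (k : Fin 3) (z : C2) :
    (affineChart k).symm z = Projectivization.mk ℂ (homog k z) (homog_ne_zero k z) := rfl

theorem affineChart_affineChart_symm (k : Fin 3) (z : C2) :
    affineChart k ((affineChart k).symm z) = z :=
  (affineChart k).right_inv (Set.mem_univ z)

theorem continuous_affineChart_symm (k : Fin 3) : Continuous (affineChart k).symm :=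
  continuousOn_univ.1 (affineChart k).continuousOn_symm

theorem isOpen_coordDomain {U : Set CP2} (hU : IsOpen U) (k : Fin 3) : IsOpen (coordDomain U k) :=
  hU.preimage (continuous_affineChart_symm k)

theorem homog_affineChart_mk (l : Fin 3) (v : C3) (hv : v ≠ 0) (hl : v l ≠ 0) :
    homog l (affineChart l (Projectivization.mk ℂ v hv)) = (v l)⁻¹ • v := by
  ext j
  rcases Fin.eq_self_or_eq_succAbove l j with rfl | ⟨i, rfl⟩
  · simp [homog_self, hl]
  · simp [homog_succAbove, affineChart_mk, div_eq_inv_mul]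

/-- The velocity of the line `t ↦ v + t w` in the `l`-th affine chart. -/
theorem hasDerivAt_line_div (v w : C3) (l j : Fin 3) (t : ℝ) (h : v l + t * w l ≠ 0) :
    HasDerivAt (fun s : ℝ => (v j + s * w j) / (v l + s * w l))
      ((w j * v l - v j * w l) / (v l + t * w l) ^ 2) t := by
  have h1 : ∀ j, HasDerivAt (fun s : ℝ => v j + s * w j) (w j) t := fun j => by
    simpa using ((Complex.ofRealCLM.hasDerivAt (x := t)).mul_const (w j)).const_add (v j)
  refine ((h1 j).div (h1 l) h).congr_deriv ?_
  congr 1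
  ring

/-- The index of the preferred chart around `[homog k z]`. -/
def symmIndex (k : Fin 3) (z : C2) : Fin 3 := index ((affineChart k).symm z)

theorem homog_symmIndex_ne_zero (k : Fin 3) (z : C2) : homog k z (symmIndex k z) ≠ 0 :=
  (mk_mem_source_iff _ _ (homog_ne_zero k z)).1 (rep_index_ne_zero ((affineChart k).symm z))

theorem point_affineChart_symm (k : Fin 3) (z : C2) :
    point ((affineChart k).symm z) = (homog k z (symmIndex k z))⁻¹ • homog k z :=
  homog_affineChart_mk _ _ _ (homog_symmIndex_ne_zero k z)

/-- The differential of the parametrisation `z ↦ [homog k z]`. -/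
def dsymm (k : Fin 3) (z : C2) : C2 →L[ℝ] C2 :=
  mfderiv 𝓘(ℝ, C2) 𝓘(ℝ, C2) (affineChart k).symm z

theorem mdifferentiableAt_symm (k : Fin 3) (z : C2) :
    MDifferentiableAt 𝓘(ℝ, C2) 𝓘(ℝ, C2) (affineChart k).symm z := by
  have : IsManifold 𝓘(ℝ, C2) 1 CP2 := IsManifold.of_le (n := ∞) (by norm_cast)
  exact mdifferentiableAt_atlas_symm (H := C2) (e := affineChart k) (Set.mem_range_self k) (Set.mem_univ z)

/-- This is the quotient rule for `v / v_l`. The second term is a multiple of `v`, hence invisible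
to `v × ·`. -/
theorem direction_dsymm (k : Fin 3) (z u : C2) :
    direction (symmIndex k z) (dsymm k z u) = (homog k z (symmIndex k z))⁻¹ • direction k u
      - ((homog k z (symmIndex k z))⁻¹ ^ 2 * direction k u (symmIndex k z)) • homog k z := by
  set l := symmIndex k z with hl
  have hne := homog_symmIndex_ne_zero k z
  rw [← hl] at hne
  have hm := mdifferentiableAt_symm k z
  have hd : HasFDerivAt (affineChart l ∘ (affineChart k).symm) (dsymm k z) z := by
    have h : HasFDerivWithinAt (affineChart l ∘ (affineChart k).symm) (dsymm k z)
        (Set.range 𝓘(ℝ, C2)) z := hm.hasMFDerivAt.2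
    rwa [modelWithCornersSelf_coe, Set.range_id, hasFDerivWithinAt_univ] at h
  have hc : HasDerivAt (fun t : ℝ => affineChart l ((affineChart k).symm (z + t • u)))
      (dsymm k z u) 0 := by
    have hline : HasDerivAt (fun t : ℝ => z + t • u) u 0 := by
      simpa using ((hasDerivAt_id (0 : ℝ)).smul_const u).const_add z
    have hd' : HasFDerivAt (affineChart l ∘ (affineChart k).symm) (dsymm k z)
        (z + (0 : ℝ) • u) := by simpa using hd
    exact hd'.comp_hasDerivAt (0 : ℝ) hline
  have hcomp : ∀ i, (dsymm k z u) i
      = (direction k u (l.succAbove i) * homog k z l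
        - homog k z (l.succAbove i) * direction k u l) / homog k z l ^ 2 := by
    intro i
    have h1 := (hasDerivAt_pi.1 hc) i
    have h2 := hasDerivAt_line_div (homog k z) (direction k u) l (l.succAbove i) 0 (by simpa using hne)
    have h3 : (fun t : ℝ => affineChart l ((affineChart k).symm (z + t • u)) i)
        = fun s : ℝ => (homog k z (l.succAbove i) + s * direction k u (l.succAbove i))
          / (homog k z l + s * direction k u l) := by
      ext t
      rw [affineChart_symm_apply, affineChart_mk, homog_add, direction_smul]
      simp
    rw [h3] at h1
    simpa using h1.unique h2
  ext j
  rcases Fin.eq_self_or_eq_succAbove l j with rfl | ⟨i, rfl⟩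
  · simp only [direction_self, Pi.sub_apply, Pi.smul_apply, smul_eq_mul]
    field_simp
    ring
  · simp only [direction_succAbove, Pi.sub_apply, Pi.smul_apply, smul_eq_mul, hcomp]
    field_simp

/-- In `direction_dsymm` the `k`-th coordinate sees only the multiple of `v`, since `v` has entry
`1` and the direction has entry `0` there. So that multiple vanishes, and what remains is a nonzero
scalar times the direction. -/
theorem dsymm_injective (k : Fin 3) (z : C2) : Function.Injective (dsymm k z) := by
  refine (injective_iff_map_eq_zero (dsymm k z)).2 fun u hu => ?_
  have h := direction_dsymm k z u
  have hne := homog_symmIndex_ne_zero k z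
  set l := symmIndex k z
  have h0 : direction l 0 = 0 := by simpa using direction_smul l 0 0
  rw [hu, h0] at h
  have hk := congrFun h k
  simp only [direction_self, homog_self, Pi.sub_apply, Pi.smul_apply, smul_eq_mul, Pi.zero_apply] at hk
  have hk' : direction k u l = 0 := by
    have : (homog k z l)⁻¹ ^ 2 * direction k u l = 0 := by linear_combination hk
    exact (mul_eq_zero.1 this).resolve_left (pow_ne_zero _ (inv_ne_zero hne))
  rw [hk'] at h
  ext i
  have hi := congrFun h (k.succAbove i)
  simpa [direction_succAbove, hne] using hi.symm

theorem dsymm_surjective (k : Fin 3) (z : C2) : Function.Surjective (dsymm k z) := by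
  have h : Function.Injective (dsymm k z : C2 →ₗ[ℝ] C2) := dsymm_injective k z
  exact LinearMap.injective_iff_surjective.1 h

theorem dsymm_I (k : Fin 3) (z u : C2) :
    dsymm k z (Complex.I • u) = Complex.I • dsymm k z u := by
  apply direction_injective (symmIndex k z)
  rw [direction_complex_smul, direction_dsymm, direction_dsymm, direction_complex_smul, smul_sub,
    smul_smul, smul_smul, smul_smul]
  congr 2
  · ring
  · simp only [Pi.smul_apply, smul_eq_mul]; ring

theorem inChart_eq (g : BilinField) (k : Fin 3) (z u w : C2) :
    g.inChart k z u w = g ((affineChart k).symm z) (dsymm k z u) (dsymm k z w) := rfl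

theorem affineChart_symm_affineChart {k : Fin 3} {p : CP2} (hp : p ∈ (affineChart k).source) :
    (affineChart k).symm (affineChart k p) = p := (affineChart k).left_inv hp

theorem mem_source_index (p : CP2) : p ∈ (affineChart (index p)).source := rep_index_ne_zero p

theorem exists_eq_affineChart_symm (p : CP2) : ∃ k z, p = (affineChart k).symm z :=
  ⟨index p, _, (affineChart_symm_affineChart (mem_source_index p)).symm⟩

/-- Fields of bilinear forms that agree in a chart agree. -/
theorem eq_of_inChart_eq {g g' : BilinField} {k : Fin 3} {z : C2}
    (h : ∀ u w, g.inChart k z u w = g'.inChart k z u w) :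
    g ((affineChart k).symm z) = g' ((affineChart k).symm z) := by
  refine LinearMap.ext fun a => LinearMap.ext fun b => ?_
  obtain ⟨u, rfl⟩ := dsymm_surjective k z a
  obtain ⟨w, rfl⟩ := dsymm_surjective k z b
  exact h u w

end Charts

section MetricOf

/-! ### Hermitian forms on covectors -/

/-- The sesquilinear form `ξᵀ C conj(η)`. -/
def hform (C : Matrix (Fin 3) (Fin 3) ℂ) (ξ η : C3) : ℂ := ξ ⬝ᵥ (C *ᵥ star η)

variable (C : Matrix (Fin 3) (Fin 3) ℂ)

theorem hform_add_left (ξ ξ' η : C3) : hform C (ξ + ξ') η = hform C ξ η + hform C ξ' η := by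
  simp [hform, add_dotProduct]

theorem hform_add_right (ξ η η' : C3) : hform C ξ (η + η') = hform C ξ η + hform C ξ η' := by
  simp [hform, Matrix.mulVec_add, dotProduct_add]

theorem hform_smul_left (a : ℂ) (ξ η : C3) : hform C (a • ξ) η = a * hform C ξ η := by
  simp [hform]

theorem hform_smul_right (a : ℂ) (ξ η : C3) : hform C ξ (a • η) = star a * hform C ξ η := by
  simp [hform, Matrix.mulVec_smul]

variable {C} in
theorem star_hform (hC : C.IsHermitian) (ξ η : C3) : star (hform C ξ η) = hform C η ξ := by
  rw [hform, hform, ← Matrix.star_dotProduct_star, Matrix.star_mulVec, hC.eq, star_star,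
    ← Matrix.dotProduct_mulVec]

theorem hform_eq_sum (ξ η : C3) : hform C ξ η = ∑ i, ξ i * ∑ j, C i j * star (η j) := rfl

theorem star_cross (u w : C3) : star (u ⨯₃ w) = star u ⨯₃ star w := by
  ext j
  fin_cases j <;> simp [cross_apply]

/-- Cauchy–Binet: the action of `C` on second exterior powers is its adjugate once `∧` is identified
with the cross product. -/
theorem hform_det (ξ₁ ξ₂ η₁ η₂ : C3) :
    hform C ξ₁ η₁ * hform C ξ₂ η₂ - hform C ξ₁ η₂ * hform C ξ₂ η₁
      = star (η₁ ⨯₃ η₂) ⬝ᵥ (C.adjugate *ᵥ (ξ₁ ⨯₃ ξ₂)) := by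
  rw [star_cross]
  simp only [hform, Matrix.adjugate_fin_three, cross_apply, dotProduct, Matrix.mulVec,
    Fin.sum_univ_three, Pi.star_apply, Matrix.of_apply, Matrix.cons_val]
  ring

/-- The linear form `v* adj(C) w` on `ℂ³`, the holomorphic derivative of `discr C` at `v`. -/
def adjForm (v w : C3) : ℂ := star v ⬝ᵥ (C.adjugate *ᵥ w)

variable {C} in
theorem star_adjForm (hC : C.IsHermitian) (v w : C3) : star (adjForm C v w) = adjForm C w v := by
  rw [adjForm, adjForm, ← Matrix.star_dotProduct, Matrix.star_mulVec, hC.adjugate.eq,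
    ← Matrix.dotProduct_mulVec]

variable {C} in
theorem ofReal_discr (hC : C.IsHermitian) (v : C3) : (discr C v : ℂ) = adjForm C v v :=
  Complex.conj_eq_iff_re.1 (star_adjForm hC v v)

theorem discr_smul (a : ℂ) (v : C3) : discr C (a • v) = Complex.normSq a * discr C v := by
  rw [discr, discr, ← Complex.re_ofReal_mul, Complex.normSq_eq_conj_mul_self]
  congr 1
  simp [Matrix.mulVec_smul, mul_assoc, mul_left_comm]

/-- The covector `v × w` of the complex line through `[v]` in the direction of `u` in the `k`-th
affine chart. -/
def crossVec (k : Fin 3) (z u : C2) : C3 := homog k z ⨯₃ direction k u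

theorem crossVec_add (k : Fin 3) (z u w : C2) :
    crossVec k z (u + w) = crossVec k z u + crossVec k z w := by
  simp [crossVec, direction_add]

theorem crossVec_smul (k : Fin 3) (c : ℂ) (z u : C2) :
    crossVec k z (c • u) = c • crossVec k z u := by
  simp [crossVec, direction_complex_smul]

/-- Rescaling the representative by `a` multiplies `v × w` by `a²`, so numerator and denominator
both acquire `|a|⁴`. The preferred chart at a point can thus be replaced by any chart. -/
theorem inChart_metricOf (k : Fin 3) (z u w : C2) :
    (metricOf C).inChart k z u w
      = (-(hform C (crossVec k z u) (crossVec k z w)) / (discr C (homog k z) : ℂ) ^ 2).re := by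
  have hne := homog_symmIndex_ne_zero k z
  have hcross : ∀ u, point ((affineChart k).symm z) ⨯₃ direction (symmIndex k z) (dsymm k z u)
      = ((homog k z (symmIndex k z))⁻¹ ^ 2) • crossVec k z u := by
    intro u
    rw [direction_dsymm, point_affineChart_symm, crossVec]
    simp [smul_smul, pow_two]
  change (-(hform C (point ((affineChart k).symm z) ⨯₃ direction (symmIndex k z) (dsymm k z u))
    (point ((affineChart k).symm z) ⨯₃ direction (symmIndex k z) (dsymm k z w)))
      / (discr C (point ((affineChart k).symm z)) : ℂ) ^ 2).re = _
  rw [hcross, hcross, point_affineChart_symm, hform_smul_left, hform_smul_right, discr_smul]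
  set a := (homog k z (symmIndex k z))⁻¹ with ha
  have ha0 : a ≠ 0 := inv_ne_zero hne
  have hs : star a ≠ 0 := star_ne_zero.2 ha0
  congr 1
  rw [Complex.ofReal_mul, Complex.normSq_eq_conj_mul_self, star_pow, ← Complex.star_def]
  have : (-(a ^ 2 * (star a ^ 2 * hform C (crossVec k z u) (crossVec k z w))))
      = (star a * a) ^ 2 * -(hform C (crossVec k z u) (crossVec k z w)) := by ring
  rw [this, mul_pow (star a * a), mul_div_mul_left _ _ (pow_ne_zero 2 (mul_ne_zero hs ha0))]

/-- The first standard basis vector of `ℂ²`. -/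
def e₁ : C2 := ![1, 0]

/-- The second standard basis vector of `ℂ²`. -/
def e₂ : C2 := ![0, 1]

@[simp] theorem e₁_zero : e₁ 0 = 1 := rfl

@[simp] theorem e₁_one : e₁ 1 = 0 := rfl

@[simp] theorem e₂_zero : e₂ 0 = 0 := rfl

@[simp] theorem e₂_one : e₂ 1 = 1 := rfl

theorem eq_smul_e (u : C2) : u = u 0 • e₁ + u 1 • e₂ := by
  ext i
  fin_cases i <;> simp

/-- An instance of `(v × a) × (v × b) = det(v, a, b) v`. The sign depends on the place of the entry
`1` and cancels in every sesquilinear expression. -/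
theorem cross_crossVec (k : Fin 3) (z : C2) :
    crossVec k z e₁ ⨯₃ crossVec k z e₂ = ((-1) ^ (k : ℕ) : ℂ) • homog k z := by
  ext j
  fin_cases k <;> fin_cases j <;>
    simp [crossVec, cross_apply, homog, direction, e₁, e₂, Fin.insertNth, Fin.succAboveCases]

variable {C} in
-- The bridge between numerator and denominator of `metricOf C`: it gives nondegeneracy, and it
-- recovers `discr C` from the determinant of the metric.
theorem hform_crossVec_det (hC : C.IsHermitian) (k : Fin 3) (z : C2) :
    hform C (crossVec k z e₁) (crossVec k z e₁) * hform C (crossVec k z e₂) (crossVec k z e₂)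
      - hform C (crossVec k z e₁) (crossVec k z e₂) * hform C (crossVec k z e₂) (crossVec k z e₁)
      = discr C (homog k z) := by
  rw [hform_det, cross_crossVec, ofReal_discr hC, adjForm, star_smul, Matrix.mulVec_smul, smul_dotProduct,
    dotProduct_smul, smul_smul]
  simp only [star_pow, star_neg, star_one, smul_eq_mul]
  rw [← mul_pow]
  simp

/-! ### The Levi-Civita connection of the metric of a hermitian form -/

theorem smul_cross_cyclic (a v u y : C3) :
    (a ⬝ᵥ v) • (u ⨯₃ y) + (a ⬝ᵥ u) • (y ⨯₃ v) + (a ⬝ᵥ y) • (v ⨯₃ u) = (v ⬝ᵥ u ⨯₃ y) • a := by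
  ext j
  fin_cases j <;> simp [cross_apply, dotProduct, Fin.sum_univ_three] <;> ring

variable {C} in
-- Apply `smul_cross_cyclic` to the covector `a = v* adj(C)` and pair it with `v × w`. The
-- right-hand side drops out, because `C conj(a) = C adj(C) v = det(C) v` is annihilated by `v × w`.
-- With `u × y` as the derivative of `v × y` along `u`, this expresses derivatives of the numerator
-- through its values.
theorem discr_mul_hform_cross (hC : C.IsHermitian) (v w u y : C3) :
    discr C v * hform C (v ⨯₃ w) (u ⨯₃ y)
      = star (adjForm C v u) * hform C (v ⨯₃ w) (v ⨯₃ y)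
        - star (adjForm C v y) * hform C (v ⨯₃ w) (v ⨯₃ u) := by
  have h1 := smul_cross_cyclic (star v ᵥ* C.adjugate) v u y
  simp only [← Matrix.dotProduct_mulVec] at h1
  have h2 : hform C (v ⨯₃ w) (star v ᵥ* C.adjugate) = 0 := by
    rw [hform, Matrix.star_vecMul, star_star, hC.adjugate.eq, Matrix.mulVec_mulVec,
      Matrix.mul_adjugate, Matrix.smul_mulVec, Matrix.one_mulVec, dotProduct_smul, dotProduct_comm,
      dot_self_cross, smul_zero]
  have h3 := congrArg (hform C (v ⨯₃ w)) h1
  rw [hform_add_right, hform_add_right, hform_smul_right, hform_smul_right, hform_smul_right,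
    hform_smul_right, h2, mul_zero, ← adjForm, ← ofReal_discr hC, ← cross_anticomm v y,
    ← neg_one_smul ℂ (v ⨯₃ y), hform_smul_right] at h3
  simp only [Complex.star_def, Complex.conj_ofReal, map_neg, map_one] at h3
  simp only [adjForm, Complex.star_def]
  linear_combination h3

/-- The Levi-Civita connection of `metricOf C`. -/
def christoffelOf (k : Fin 3) (z u w : C2) : C2 :=
  -((adjForm C (homog k z) (direction k u) / discr C (homog k z)) • w
    + (adjForm C (homog k z) (direction k w) / discr C (homog k z)) • u)

variable {C} in
theorem discr_add_smul (hC : C.IsHermitian) (v w : C3) (t : ℝ) :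
    discr C (v + (t : ℂ) • w) = discr C v + t * (2 * (adjForm C v w).re) + t ^ 2 * discr C w := by
  have h : (star w ⬝ᵥ (C.adjugate *ᵥ v)) = star (star v ⬝ᵥ (C.adjugate *ᵥ w)) :=
    (star_adjForm hC v w).symm
  simp only [discr, adjForm, star_add, star_smul, add_dotProduct, Matrix.mulVec_add,
    Matrix.mulVec_smul, dotProduct_add, smul_dotProduct, dotProduct_smul, h, smul_eq_mul,
    Complex.star_def, Complex.conj_ofReal, Complex.add_re, Complex.re_ofReal_mul, Complex.conj_re]
  ring

theorem contDiff_homog (k : Fin 3) : ContDiff ℝ ∞ (homog k) := by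
  refine contDiff_pi.2 fun j => ?_
  rcases Fin.eq_self_or_eq_succAbove k j with rfl | ⟨i, rfl⟩
  · simpa only [homog_self] using contDiff_const
  · simpa only [homog_succAbove] using contDiff_apply ℝ ℂ i

theorem contDiff_crossVec (k : Fin 3) (u : C2) : ContDiff ℝ ∞ fun z => crossVec k z u := by
  have h := contDiff_pi.1 (contDiff_homog k)
  refine contDiff_pi.2 fun j => ?_
  fin_cases j <;> simp only [crossVec, cross_apply] <;>
    exact ((h _).mul contDiff_const).sub ((h _).mul contDiff_const)

theorem contDiff_conj : ContDiff ℝ ∞ (star : ℂ → ℂ) := Complex.conjCLE.contDiff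

theorem contDiff_discr_homog (k : Fin 3) : ContDiff ℝ ∞ fun z => discr C (homog k z) := by
  have h := contDiff_pi.1 (contDiff_homog k)
  have h' : ContDiff ℝ ∞ fun z => ∑ i, star (homog k z i) * ∑ j, C.adjugate i j * homog k z j :=
    ContDiff.sum fun i _ => (contDiff_conj.comp (h i)).mul
      (ContDiff.sum fun j _ => contDiff_const.mul (h j))
  exact Complex.reCLM.contDiff.comp h'

theorem contDiff_hform_crossVec (k : Fin 3) (u w : C2) :
    ContDiff ℝ ∞ fun z => hform C (crossVec k z u) (crossVec k z w) := by
  simp only [hform_eq_sum]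
  refine ContDiff.sum fun i _ => ?_
  refine ContDiff.mul (contDiff_pi.1 (contDiff_crossVec k u) i) (ContDiff.sum fun j _ => ?_)
  exact contDiff_const.mul (contDiff_conj.comp (contDiff_pi.1 (contDiff_crossVec k w) j))

theorem contDiffAt_inChart_metricOf (k : Fin 3) (z u w : C2) (hz : discr C (homog k z) ≠ 0) :
    ContDiffAt ℝ ∞ (fun x => (metricOf C).inChart k x u w) z := by
  simp only [inChart_metricOf, div_eq_mul_inv]
  have h1 : ContDiffAt ℝ ∞ (fun x => (discr C (homog k x) : ℂ) ^ 2) z :=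
    ((Complex.ofRealCLM.contDiff.comp (contDiff_discr_homog C k)).pow 2).contDiffAt
  have h0 : (discr C (homog k z) : ℂ) ^ 2 ≠ 0 := pow_ne_zero 2 (Complex.ofReal_ne_zero.2 hz)
  have h2 := (contDiff_hform_crossVec C k u w).neg.contDiffAt.mul (h1.inv h0)
  exact Complex.reCLM.contDiff.contDiffAt.comp z h2

end MetricOf

section Compatible

variable {C : Matrix (Fin 3) (Fin 3) ℂ}

theorem crossVec_line (k : Fin 3) (z u w : C2) (t : ℝ) :
    crossVec k (z + t • u) w = crossVec k z w + (t : ℂ) • (direction k u ⨯₃ direction k w) := by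
  simp [crossVec, homog_add, direction_smul]

theorem hasDerivAt_line (z u : C2) : HasDerivAt (fun t : ℝ => z + t • u) u 0 := by
  simpa using ((hasDerivAt_id (0 : ℝ)).smul_const u).const_add z

/-- The directional derivatives of `metricOf C` in an affine chart. -/
theorem fderiv_inChart_metricOf (hC : C.IsHermitian) (k : Fin 3) (z u w y : C2)
    (hz : discr C (homog k z) ≠ 0) :
    discr C (homog k z) ^ 3 * fderiv ℝ (fun x => (metricOf C).inChart k x w y) z u
      = (2 * (adjForm C (homog k z) (direction k u)).re
            * hform C (crossVec k z w) (crossVec k z y)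
          + adjForm C (homog k z) (direction k w) * hform C (crossVec k z u) (crossVec k z y)
          + star (adjForm C (homog k z) (direction k y))
            * hform C (crossVec k z w) (crossVec k z u)).re := by
  have hdiff := (contDiffAt_inChart_metricOf C k z w y hz).differentiableAt (by simp)
  have hline := hasDerivAt_line z u
  have h1 : HasDerivAt (fun t : ℝ => (metricOf C).inChart k (z + t • u) w y)
      (fderiv ℝ (fun x => (metricOf C).inChart k x w y) z u) 0 := by
    have hd' : HasFDerivAt (fun x => (metricOf C).inChart k x w y)
      (fderiv ℝ (fun x => (metricOf C).inChart k x w y) z) (z + (0 : ℝ) • u) := by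
      simpa using hdiff.hasFDerivAt
    exact hd'.comp_hasDerivAt (0 : ℝ) hline
  set D := discr C (homog k z) with hD
  set α := adjForm C (homog k z) (direction k u) with hα
  set N := hform C (crossVec k z w) (crossVec k z y)
  set X := hform C (crossVec k z w) (direction k u ⨯₃ direction k y) with hX
  set Y := hform C (direction k u ⨯₃ direction k w) (crossVec k z y) with hY
  set Z := hform C (direction k u ⨯₃ direction k w) (direction k u ⨯₃ direction k y)
  set d := discr C (direction k u)
  -- On a real line both numerator and denominator are quadratic polynomials in `t`, so only their
  -- linear coefficients matter at `t = 0`.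
  have hfun : (fun t : ℝ => (metricOf C).inChart k (z + t • u) w y) = fun t : ℝ =>
      (-(N + t * (X + Y) + t * (t * Z)) / ((D : ℂ) + t * (2 * α.re) + t * (t * d)) ^ 2).re := by
    ext t
    rw [inChart_metricOf, crossVec_line, crossVec_line, homog_add, direction_smul,
      discr_add_smul hC]
    congr 1
    simp only [hform_add_left, hform_add_right, hform_smul_left, hform_smul_right,
      Complex.star_def, Complex.conj_ofReal]
    push_cast
    congr 1
    · ring
    · ring
  have hT : HasDerivAt (fun t : ℝ => (t : ℂ)) 1 0 := Complex.ofRealCLM.hasDerivAt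
  have hpoly : ∀ a b c : ℂ, HasDerivAt (fun t : ℝ => a + t * b + t * (t * c)) b 0 := by
    intro a b c
    have := ((hT.mul_const b).const_add a).add (hT.mul (hT.mul_const c))
    simpa using! this
  have hDc : (D : ℂ) ≠ 0 := Complex.ofReal_ne_zero.2 hz
  have h2 := (hpoly N (X + Y) Z).neg.div ((hpoly D (2 * α.re) d).pow 2) (by simpa using hDc)
  have h3 : HasDerivAt (fun t : ℝ =>
      (-(N + t * (X + Y) + t * (t * Z)) / ((D : ℂ) + t * (2 * α.re) + t * (t * d)) ^ 2).re)
      _ 0 := Complex.reCLM.hasFDerivAt.comp_hasDerivAt (0 : ℝ) h2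
  rw [hfun] at h1
  rw [h1.unique h3]
  have hXe : D * X = star α * N
      - star (adjForm C (homog k z) (direction k y)) * hform C (crossVec k z w) (crossVec k z u) :=
    discr_mul_hform_cross hC _ _ _ _
  have hYe : D * Y = α * N
      - adjForm C (homog k z) (direction k w) * hform C (crossVec k z u) (crossVec k z y) := by
    have := congrArg star (discr_mul_hform_cross hC (homog k z) (direction k y) (direction k u)
      (direction k w))
    rw [star_sub, star_mul', star_mul', star_mul', star_star, star_star, star_hform hC,
      star_hform hC, star_hform hC] at this
    simpa using! this
  have hre : (2 * α.re : ℂ) = α + star α := by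
    rw [Complex.star_def, Complex.add_conj]; push_cast; ring
  have hval : ∀ q r : ℂ, q = r → D ^ 3 * (Complex.reCLM q) = ((D : ℂ) ^ 3 * r).re := by
    rintro q _ rfl
    rw [← Complex.ofReal_pow, Complex.re_ofReal_mul]
    rfl
  rw [hval _ ((-(X + Y) * D + 2 * N * (α + star α)) / (D : ℂ) ^ 3)]
  · congr 1
    rw [hre]
    field_simp
    linear_combination (-1) * hXe - hYe
  · rw [hre]
    simp
    field_simp

/-- The Koszul formula for the value `a = Γ(u, w)` of the Levi-Civita connection. -/
def IsKoszul (g : BilinField) (k : Fin 3) (z u w a : C2) : Prop :=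
  ∀ y : C2, g.inChart k z a y =
    (fderiv ℝ (fun x => g.inChart k x w y) z u + fderiv ℝ (fun x => g.inChart k x u y) z w
      - fderiv ℝ (fun x => g.inChart k x u w) z y) / 2

/-- After multiplication by `discr³`, the terms of the three derivatives that involve `y` through
`adjForm` cancel by hermitian symmetry. The others combine to the pairing of `christoffelOf` with
`y`. -/
theorem isKoszul_christoffelOf (hC : C.IsHermitian) (k : Fin 3) (z u w : C2)
    (hz : discr C (homog k z) ≠ 0) :
    IsKoszul (metricOf C) k z u w (christoffelOf C k z u w) := by
  intro y
  have h1 := fderiv_inChart_metricOf hC k z u w y hz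
  have h2 := fderiv_inChart_metricOf hC k z w u y hz
  have h3 := fderiv_inChart_metricOf hC k z y u w hz
  have hD3 : discr C (homog k z) ^ 3 ≠ 0 := pow_ne_zero 3 hz
  refine mul_left_cancel₀ hD3 ?_
  have h4 : discr C (homog k z) ^ 3 * (metricOf C).inChart k z (christoffelOf C k z u w) y
      = (adjForm C (homog k z) (direction k u) * hform C (crossVec k z w) (crossVec k z y)
        + adjForm C (homog k z) (direction k w) * hform C (crossVec k z u) (crossVec k z y)).re := by
    rw [inChart_metricOf, ← Complex.re_ofReal_mul]
    congr 1
    have hDc : (discr C (homog k z) : ℂ) ≠ 0 := Complex.ofReal_ne_zero.2 hz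
    have : crossVec k z (christoffelOf C k z u w)
        = (-1 : ℂ) • ((adjForm C (homog k z) (direction k u) / discr C (homog k z))
          • crossVec k z w + (adjForm C (homog k z) (direction k w) / discr C (homog k z))
          • crossVec k z u) := by
      rw [christoffelOf, ← neg_one_smul ℂ, crossVec_smul, crossVec_add, crossVec_smul,
        crossVec_smul]
    rw [this, hform_smul_left, hform_add_left, hform_smul_left, hform_smul_left]
    push_cast
    field_simp
  have h5 := star_hform hC (crossVec k z u) (crossVec k z w)
  have h6 := star_hform hC (crossVec k z w) (crossVec k z y)
  have h7 := star_hform hC (crossVec k z u) (crossVec k z y)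
  rw [h4]
  rw [← h5] at h1
  rw [← h6] at h3
  rw [mul_div_assoc', mul_sub, mul_add, h1, h2, h3]
  simp only [Complex.add_re, Complex.mul_re, Complex.mul_im, Complex.ofReal_re, Complex.ofReal_im,
    Complex.star_def, Complex.conj_re, Complex.conj_im, Complex.re_ofNat, Complex.im_ofNat]
  ring

/-! ### Bilinear forms in affine charts -/

section inChart

variable (g : BilinField) (k : Fin 3) (z : C2)

theorem inChart_add_left (u u' w : C2) :
    g.inChart k z (u + u') w = g.inChart k z u w + g.inChart k z u' w := by
  rw [inChart_eq, map_add]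
  exact LinearMap.map_add₂ _ _ _ _

theorem inChart_add_right (u w w' : C2) :
    g.inChart k z u (w + w') = g.inChart k z u w + g.inChart k z u w' := by
  rw [inChart_eq, map_add]
  exact map_add (g ((affineChart k).symm z) (dsymm k z u)) _ _

theorem inChart_smul_left (c : ℝ) (u w : C2) :
    g.inChart k z (c • u) w = c * g.inChart k z u w := by
  rw [inChart_eq, map_smul]
  exact LinearMap.map_smul₂ _ _ _ _

theorem inChart_smul_right (c : ℝ) (u w : C2) :
    g.inChart k z u (c • w) = c * g.inChart k z u w := by
  rw [inChart_eq, map_smul]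
  exact map_smul (g ((affineChart k).symm z) (dsymm k z u)) _ _

theorem inChart_sub_left (u u' w : C2) :
    g.inChart k z (u - u') w = g.inChart k z u w - g.inChart k z u' w := by
  have := inChart_add_left g k z (u - u') u' w
  rw [sub_add_cancel] at this
  linarith

variable {g k z}

theorem inChart_I_I {U : Set CP2} (h : ∀ p ∈ U, ∀ u w : Tan p, g p (J u) (J w) = g p u w)
    (hz : z ∈ coordDomain U k) (u w : C2) :
    g.inChart k z (Complex.I • u) (Complex.I • w) = g.inChart k z u w := by
  rw [inChart_eq, dsymm_I, dsymm_I]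
  exact h _ hz _ _

theorem inChart_nondegenerate {U : Set CP2}
    (h : ∀ p ∈ U, ∀ u : Tan p, (∀ w : Tan p, g p u w = 0) → u = 0)
    (hz : z ∈ coordDomain U k) (u : C2) (hu : ∀ w, g.inChart k z u w = 0) : u = 0 := by
  apply dsymm_injective k z
  rw [map_zero]
  refine h _ hz _ fun w => ?_
  obtain ⟨w', rfl⟩ := dsymm_surjective k z w
  exact hu w'

/-- Nondegeneracy makes the Koszul solution unique, so any explicit solution is the value chosen by
`epsilon`. -/
theorem leviCivita_eq (hnd : ∀ u, (∀ w, g.inChart k z u w = 0) → u = 0) {u w a : C2}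
    (ha : IsKoszul g k z u w a) : leviCivita g k z u w = a := by
  have h : IsKoszul g k z u w (leviCivita g k z u w) := Classical.epsilon_spec ⟨a, ha⟩
  refine sub_eq_zero.1 (hnd _ fun y => ?_)
  rw [inChart_sub_left, h y, ha y, sub_self]

end inChart

/-! ### The metrics of hermitian forms are compatible -/

theorem symm_mem_regularSet_iff (k : Fin 3) (z : C2) :
    (affineChart k).symm z ∈ regularSet C ↔ discr C (homog k z) ≠ 0 := by
  rw [regularSet, Set.mem_ofPred_eq, point_affineChart_symm, discr_smul]
  have := homog_symmIndex_ne_zero k z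
  simp [this]

theorem inChart_metricOf_I (k : Fin 3) (z u w : C2) :
    (metricOf C).inChart k z u (Complex.I • w)
      = (-(hform C (crossVec k z u) (crossVec k z w)) / (discr C (homog k z) : ℂ) ^ 2).im := by
  rw [inChart_metricOf, crossVec_smul, hform_smul_right]
  have : ∀ a b : ℂ, -(star Complex.I * a) / b = Complex.I * -(-a / b) := by
    intro a b; simp; ring
  rw [this, Complex.I_mul_re]
  simp

/-- Testing `w` and `i w` kills the whole complex form. Cramer's rule then applies, the Gram
determinant on `e₁, e₂` being `discr`. -/
theorem metricOf_nondegenerate (hC : C.IsHermitian) {k : Fin 3} {z : C2}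
    (hz : discr C (homog k z) ≠ 0) (u : C2) (hu : ∀ w, (metricOf C).inChart k z u w = 0) :
    u = 0 := by
  have hDc : (discr C (homog k z) : ℂ) ≠ 0 := Complex.ofReal_ne_zero.2 hz
  have h : ∀ w, hform C (crossVec k z u) (crossVec k z w) = 0 := by
    intro w
    have h0 : -(hform C (crossVec k z u) (crossVec k z w)) / (discr C (homog k z) : ℂ) ^ 2 = 0 :=
      Complex.ext (by rw [← inChart_metricOf, hu]; rfl) (by rw [← inChart_metricOf_I, hu]; rfl)
    simpa [hDc] using h0
  have hdet := hform_crossVec_det hC k z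
  have h1 := h e₁
  have h2 := h e₂
  rw [eq_smul_e u, crossVec_add, crossVec_smul, crossVec_smul, hform_add_left, hform_smul_left,
    hform_smul_left] at h1 h2
  have hu0 : u 0 = 0 := by
    refine (mul_eq_zero.1 (?_ : u 0 * (discr C (homog k z) : ℂ) = 0)).resolve_right hDc
    rw [← hdet]
    linear_combination hform C (crossVec k z e₂) (crossVec k z e₂) * h1
      - hform C (crossVec k z e₂) (crossVec k z e₁) * h2
  have hu1 : u 1 = 0 := by
    refine (mul_eq_zero.1 (?_ : u 1 * (discr C (homog k z) : ℂ) = 0)).resolve_right hDc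
    rw [← hdet]
    linear_combination hform C (crossVec k z e₁) (crossVec k z e₁) * h2
      - hform C (crossVec k z e₁) (crossVec k z e₂) * h1
  rw [eq_smul_e u, hu0, hu1]
  simp

theorem leviCivita_metricOf (hC : C.IsHermitian) {k : Fin 3} {z : C2}
    (hz : discr C (homog k z) ≠ 0) (u w : C2) :
    leviCivita (metricOf C) k z u w = christoffelOf C k z u w :=
  leviCivita_eq (metricOf_nondegenerate hC hz) (isKoszul_christoffelOf hC k z u w hz)

theorem isPseudoKahler_metricOf (hC : C.IsHermitian) {U : Set CP2} (hU : U ⊆ regularSet C) :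
    IsPseudoKahler (metricOf C) U := by
  have hreg : ∀ {k z}, z ∈ coordDomain U k → discr C (homog k z) ≠ 0 :=
    fun hz => (symm_mem_regularSet_iff _ _).1 (hU hz)
  refine ⟨fun k u w z hz => ?_, fun p hp a b => ?_, fun p hp a ha => ?_, fun p hp a b => ?_,
    fun k z hz u w => ?_⟩
  · exact (contDiffAt_inChart_metricOf C k z u w (hreg hz)).contDiffWithinAt
  · obtain ⟨k, z, rfl⟩ := exists_eq_affineChart_symm p
    obtain ⟨u, rfl⟩ := dsymm_surjective k z a
    obtain ⟨w, rfl⟩ := dsymm_surjective k z b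
    rw [← inChart_eq, ← inChart_eq, inChart_metricOf, inChart_metricOf, ← star_hform hC,
      ← Complex.conj_re]
    congr 1
    simp
  · obtain ⟨k, z, rfl⟩ := exists_eq_affineChart_symm p
    obtain ⟨u, rfl⟩ := dsymm_surjective k z a
    have := metricOf_nondegenerate hC (hreg hp) u fun w => ha (dsymm k z w)
    rw [this, map_zero]
    rfl
  · obtain ⟨k, z, rfl⟩ := exists_eq_affineChart_symm p
    obtain ⟨u, rfl⟩ := dsymm_surjective k z a
    obtain ⟨w, rfl⟩ := dsymm_surjective k z b
    change metricOf C _ (Complex.I • dsymm k z u : C2) (Complex.I • dsymm k z w : C2) = _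
    rw [← dsymm_I, ← dsymm_I, ← inChart_eq, ← inChart_eq, inChart_metricOf, inChart_metricOf,
      crossVec_smul, crossVec_smul, hform_smul_left, hform_smul_right]
    congr 2
    rw [← mul_assoc]
    simp
  · rw [leviCivita_metricOf hC (hreg hz), leviCivita_metricOf hC (hreg hz), christoffelOf,
      christoffelOf, direction_complex_smul]
    simp only [adjForm, Matrix.mulVec_smul, dotProduct_smul, smul_neg, smul_add, smul_smul,
      smul_eq_mul]
    congr 3 <;> ring

theorem leviCivita_metricOf_self (hC : C.IsHermitian) {k : Fin 3} {z : C2}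
    (hz : discr C (homog k z) ≠ 0) (u : C2) :
    ∃ c : ℂ, leviCivita (metricOf C) k z u u = c • u := by
  rw [leviCivita_metricOf hC hz, christoffelOf, ← add_smul, ← neg_smul]
  exact ⟨_, rfl⟩

theorem isHermitian_neg_one : (-1 : Matrix (Fin 3) (Fin 3) ℂ).IsHermitian := by
  simp [Matrix.IsHermitian]

theorem adjugate_neg_one : (-1 : Matrix (Fin 3) (Fin 3) ℂ).adjugate = 1 := by
  rw [Matrix.adjugate_fin_three]
  ext i j
  fin_cases i <;> fin_cases j <;> simp

theorem discr_neg_one (v : C3) : (discr (-1) v : ℂ) = herm v v := by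
  rw [ofReal_discr isHermitian_neg_one, adjForm, adjugate_neg_one, Matrix.one_mulVec, herm,
    dotProduct_comm]

open scoped ComplexOrder in
theorem discr_neg_one_ne_zero {v : C3} (hv : v ≠ 0) : discr (-1) v ≠ 0 := by
  rw [← Complex.ofReal_ne_zero, discr_neg_one, herm]
  exact fun h => hv (dotProduct_self_star_eq_zero.1 h)

/-- The numerators agree by the Binet–Cauchy identity for `(v × w) · conj(v × w')`. -/
theorem fubiniStudy_eq : fubiniStudy = metricOf (-1) := by
  funext p
  refine LinearMap.ext fun a => LinearMap.ext fun b => ?_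
  change (_ / _ : ℂ).re = (_ / _ : ℂ).re
  rw [discr_neg_one]
  congr 2
  rw [Matrix.neg_mulVec, Matrix.one_mulVec, dotProduct_neg, neg_neg, star_cross, cross_dot_cross]
  simp only [herm]
  ring

theorem leviCivita_fubiniStudy_self (k : Fin 3) (z u : C2) :
    ∃ c : ℂ, leviCivita fubiniStudy k z u u = c • u := by
  rw [fubiniStudy_eq]
  exact leviCivita_metricOf_self isHermitian_neg_one (discr_neg_one_ne_zero (homog_ne_zero k z)) u

/-- In every affine chart `Γ(u, u)` is a complex multiple of `u`, so that the affine lines over `U` are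
generalised geodesics of `Γ`. -/
def IsPlanar (Γ : Christoffel) (U : Set CP2) : Prop :=
  ∀ k, ∀ z ∈ coordDomain U k, ∀ u, u ≠ 0 → ∃ c : ℂ, Γ k z u u = c • u

theorem IsPlanar.isGeneralisedGeodesic {Γ Γ' : Christoffel} {U : Set CP2} (h : IsPlanar Γ U)
    (h' : IsPlanar Γ' U) {I : Set ℝ} {γ : ℝ → CP2} (hγ : Set.MapsTo γ I U)
    (H : IsGeneralisedGeodesic Γ I γ) : IsGeneralisedGeodesic Γ' I γ := by
  refine ⟨H.smooth, H.immersed, fun t ht k hk => ?_⟩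
  have hz : affineChart k (γ t) ∈ coordDomain U k := by
    change (affineChart k).symm (affineChart k (γ t)) ∈ U
    rw [affineChart_symm_affineChart hk]
    exact hγ ht
  obtain ⟨a, ha⟩ := H.planar t ht k hk
  obtain ⟨b, hb⟩ := h k _ hz _ (H.immersed t ht k hk)
  obtain ⟨c, hc⟩ := h' k _ hz _ (H.immersed t ht k hk)
  refine ⟨a - b + c, ?_⟩
  rw [hb] at ha
  rw [hc, add_smul, sub_smul, ← ha]
  abel

theorem isPlanar_fubiniStudy (U : Set CP2) : IsPlanar (leviCivita fubiniStudy) U :=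
  fun k z _ u _ => leviCivita_fubiniStudy_self k z u

theorem isCompatibleMetric_metricOf (hC : C.IsHermitian) {U : Set CP2} (hU : U ⊆ regularSet C) :
    IsCompatibleMetric (metricOf C) U := by
  have h : IsPlanar (leviCivita (metricOf C)) U := fun k z hz u _ =>
    leviCivita_metricOf_self hC ((symm_mem_regularSet_iff _ _).1 (hU hz)) u
  exact ⟨isPseudoKahler_metricOf hC hU, fun I γ _ _ hγ =>
    ⟨h.isGeneralisedGeodesic (isPlanar_fubiniStudy U) hγ,
      (isPlanar_fubiniStudy U).isGeneralisedGeodesic h hγ⟩⟩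

end Compatible

section Lines

/-! ### Lines as generalised geodesics -/

section Line

variable (k : Fin 3) (z u : C2)

/-- The real line through `z` in the direction `u` of the `k`-th affine chart. -/
def chartLine (t : ℝ) : CP2 := (affineChart k).symm (z + t • u)

theorem affineChart_chartLine (l : Fin 3) :
    affineChart l ∘ chartLine k z u = fun t : ℝ => fun i =>
      (homog k z (l.succAbove i) + t * direction k u (l.succAbove i))
        / (homog k z l + t * direction k u l) := by
  ext t i
  rw [Function.comp, chartLine, affineChart_symm_apply, affineChart_mk, homog_add, direction_smul]
  simp

theorem chartLine_mem_source_iff (l : Fin 3) (t : ℝ) :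
    chartLine k z u t ∈ (affineChart l).source ↔ homog k z l + t * direction k u l ≠ 0 := by
  rw [chartLine, affineChart_symm_apply, mk_mem_source_iff, homog_add, direction_smul]
  simp

/-- The numerators of the velocity of a line in the `l`-th affine chart. -/
def lineNum (l : Fin 3) : C2 := fun i =>
  direction k u (l.succAbove i) * homog k z l - homog k z (l.succAbove i) * direction k u l

theorem deriv_affineChart_chartLine (l : Fin 3) (t : ℝ)
    (h : homog k z l + t * direction k u l ≠ 0) :
    deriv (affineChart l ∘ chartLine k z u) t
      = ((homog k z l + t * direction k u l) ^ 2)⁻¹ • lineNum k z u l := by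
  rw [affineChart_chartLine]
  refine HasDerivAt.deriv (hasDerivAt_pi.2 fun i => ?_)
  refine (hasDerivAt_line_div _ _ l (l.succAbove i) t h).congr_deriv ?_
  simp [lineNum, div_eq_inv_mul]

/-- In every chart the velocity is a complex scalar function times the fixed vector `lineNum`. The
acceleration is therefore a complex, generally non-real, multiple of the velocity. -/
theorem deriv_deriv_affineChart_chartLine (l : Fin 3) (t : ℝ)
    (h : homog k z l + t * direction k u l ≠ 0) :
    deriv (deriv (affineChart l ∘ chartLine k z u)) t
      = (-2 * direction k u l / (homog k z l + t * direction k u l))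
        • deriv (affineChart l ∘ chartLine k z u) t := by
  have hlin : HasDerivAt (fun s : ℝ => homog k z l + s * direction k u l) (direction k u l) t := by
    simpa using ((Complex.ofRealCLM.hasDerivAt (x := t)).mul_const
      (direction k u l)).const_add (homog k z l)
  have hev : deriv (affineChart l ∘ chartLine k z u) =ᶠ[nhds t] fun s : ℝ =>
      ((homog k z l + s * direction k u l) ^ 2)⁻¹ • lineNum k z u l := by
    filter_upwards [hlin.continuousAt.eventually_ne h] with s hs
    exact deriv_affineChart_chartLine k z u l s hs
  rw [hev.deriv_eq, deriv_affineChart_chartLine k z u l t h, smul_smul]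
  refine (((hlin.pow 2).inv (pow_ne_zero 2 h)).smul_const (lineNum k z u l)).deriv.trans ?_
  congr 1
  simp only [Pi.pow_apply, Nat.cast_ofNat, Nat.add_one_sub_one, pow_one]
  field_simp

theorem lineNum_ne_zero (hu : u ≠ 0) (l : Fin 3) (t : ℝ)
    (h : homog k z l + t * direction k u l ≠ 0) : lineNum k z u l ≠ 0 := by
  intro h0
  have hall : ∀ j, direction k u j * homog k z l - homog k z j * direction k u l = 0 := by
    intro j
    rcases Fin.eq_self_or_eq_succAbove l j with rfl | ⟨i, rfl⟩
    · ring
    · exact congrFun h0 i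
  have hk := hall k
  rw [direction_self, homog_self] at hk
  have hl : direction k u l = 0 := by linear_combination -hk
  rw [hl] at h hall
  refine hu (funext fun i => ?_)
  have hi := hall (k.succAbove i)
  rw [direction_succAbove] at hi
  have hne : homog k z l ≠ 0 := by simpa using h
  simpa [hne] using hi

theorem contMDiff_chartLine : ContMDiff 𝓘(ℝ, ℝ) 𝓘(ℝ, C2) ∞ (chartLine k z u) := by
  have h1 : ContMDiffOn 𝓘(ℝ, C2) 𝓘(ℝ, C2) ∞ (affineChart k).symm (affineChart k).target :=
    contMDiffOn_symm_of_mem_maximalAtlas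
      (IsManifold.subset_maximalAtlas (Set.mem_range_self k))
  have h2 : ContMDiff 𝓘(ℝ, ℝ) 𝓘(ℝ, C2) ∞ fun t : ℝ => z + t • u :=
    (contDiff_const.add (contDiff_id.smul contDiff_const)).contMDiff
  rw [← contMDiffOn_univ] at h2 ⊢
  exact h1.comp h2 fun t _ => Set.mem_univ _

variable {u} in
theorem isGeneralisedGeodesic_chartLine {Γ : Christoffel} {U : Set CP2} (hΓ : IsPlanar Γ U)
    (hu : u ≠ 0) {I : Set ℝ} (hI : Set.MapsTo (chartLine k z u) I U) :
    IsGeneralisedGeodesic Γ I (chartLine k z u) := by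
  have himm : ∀ t ∈ I, ∀ l, chartLine k z u t ∈ (affineChart l).source →
      deriv (affineChart l ∘ chartLine k z u) t ≠ 0 := by
    intro t _ l hl
    rw [chartLine_mem_source_iff] at hl
    rw [deriv_affineChart_chartLine k z u l t hl]
    exact smul_ne_zero (inv_ne_zero (pow_ne_zero 2 hl)) (lineNum_ne_zero k z u hu l t hl)
  refine ⟨(contMDiff_chartLine k z u).contMDiffOn, himm, fun t ht l hl => ?_⟩
  have hz : affineChart l (chartLine k z u t) ∈ coordDomain U l := by
    change (affineChart l).symm (affineChart l (chartLine k z u t)) ∈ U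
    rw [affineChart_symm_affineChart hl]
    exact hI ht
  obtain ⟨c, hc⟩ := hΓ l _ hz _ (himm t ht l hl)
  rw [hc, deriv_deriv_affineChart_chartLine k z u l t
    ((chartLine_mem_source_iff k z u l t).1 hl), ← add_smul]
  exact ⟨_, rfl⟩

end Line

/-- A short line through `z` in direction `u` is a generalised geodesic of Fubini–Study, hence of
`Γ`. In its own chart its second derivative is zero, so planarity at time `0` reads `Γ(u, u) = c u`.
-/
theorem isPlanar_of_equivalent {Γ : Christoffel} {U : Set CP2} (hU : IsOpen U)
    (h : ComplexProjectivelyEquivalent Γ (leviCivita fubiniStudy) U) : IsPlanar Γ U := by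
  intro k z hz u hu
  have hcont : Continuous (chartLine k z u) := (contMDiff_chartLine k z u).continuous
  have h0 : chartLine k z u 0 ∈ U := by simpa [chartLine] using! hz
  obtain ⟨ε, hε, hball⟩ := Metric.isOpen_iff.1 (hU.preimage hcont) 0 h0
  have hI : Set.MapsTo (chartLine k z u) (Metric.ball 0 ε) U := fun t ht => hball ht
  have hord : (Metric.ball (0 : ℝ) ε).OrdConnected := by
    rw [Real.ball_eq_Ioo]
    exact Set.ordConnected_Ioo
  have hgeo := (h _ _ Metric.isOpen_ball hord hI).2
    (isGeneralisedGeodesic_chartLine k z (isPlanar_fubiniStudy U) hu hI)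
  have hsrc : chartLine k z u 0 ∈ (affineChart k).source :=
    (affineChart k).map_target (Set.mem_univ _)
  obtain ⟨c, hc⟩ := hgeo.planar 0 (Metric.mem_ball_self hε) k hsrc
  have hfun : affineChart k ∘ chartLine k z u = fun t : ℝ => z + t • u := by
    ext1 t
    exact affineChart_affineChart_symm k _
  have hder : deriv (affineChart k ∘ chartLine k z u) = fun _ => u := by
    rw [hfun]
    ext1 t
    have : HasDerivAt (fun t : ℝ => z + t • u) u t := by
      simpa using ((hasDerivAt_id t).smul_const u).const_add z
    exact this.deriv
  have hpt : affineChart k (chartLine k z u 0) = z := by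
    have := congrFun hfun 0
    simpa using this
  rw [hder, hpt] at hc
  exact ⟨c, by simpa using hc⟩

end Lines

section Rigidity

/-! ### Hermitian forms that are constant along lines -/

/-- The hermitian form on `ℂ²` with the matrix entries `A`, `B`, `conj B`, `D`. -/
def hermForm (A D : ℝ) (B u₁ u₂ : ℂ) : ℝ :=
  A * Complex.normSq u₁ + D * Complex.normSq u₂ + 2 * (B * u₁ * star u₂).re

/-- The polarisation of `hermForm` as a linear form. -/
def hermPol (A D : ℝ) (B w₁ w₂ d₁ d₂ : ℂ) : ℂ :=
  A * star w₁ * d₁ + D * star w₂ * d₂ + star (B * w₁) * d₂ + B * d₁ * star w₂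

theorem hermForm_smul (A D : ℝ) (B ζ d₁ d₂ : ℂ) :
    hermForm A D B (ζ * d₁) (ζ * d₂) = Complex.normSq ζ * hermForm A D B d₁ d₂ := by
  simp only [hermForm, Complex.normSq_apply, Complex.mul_re, Complex.mul_im, Complex.star_def,
    Complex.conj_re, Complex.conj_im]
  ring

theorem hermForm_sub (A D : ℝ) (B w₁ w₂ ζ d₁ d₂ : ℂ) :
    hermForm A D B (w₁ - ζ * d₁) (w₂ - ζ * d₂) = hermForm A D B w₁ w₂
      + Complex.normSq ζ * hermForm A D B d₁ d₂ - 2 * (hermPol A D B w₁ w₂ d₁ d₂ * ζ).re := by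
  simp only [hermForm, hermPol, Complex.normSq_apply, Complex.mul_re, Complex.mul_im,
    Complex.star_def, Complex.conj_re, Complex.conj_im, Complex.sub_re, Complex.sub_im,
    Complex.add_re, Complex.add_im, Complex.ofReal_re, Complex.ofReal_im]
  ring

theorem hermForm_neg_sub (A D : ℝ) (B w₁ w₂ ζ d₁ d₂ : ℂ) :
    hermForm A D B (-w₁ - ζ * d₁) (-w₂ - ζ * d₂) = hermForm A D B w₁ w₂
      + Complex.normSq ζ * hermForm A D B d₁ d₂ + 2 * (hermPol A D B w₁ w₂ d₁ d₂ * ζ).re := by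
  simp only [hermForm, hermPol, Complex.normSq_apply, Complex.mul_re, Complex.mul_im,
    Complex.star_def, Complex.conj_re, Complex.conj_im, Complex.sub_re, Complex.sub_im,
    Complex.add_re, Complex.add_im, Complex.ofReal_re, Complex.ofReal_im, Complex.neg_re,
    Complex.neg_im]
  ring

/-- A field of hermitian forms over a polydisc is constant along complex lines. -/
def ConstOnLines (r : ℝ) (A D : ℂ → ℂ → ℝ) (B : ℂ → ℂ → ℂ) : Prop :=
  ∀ z₁ z₂ y₁ y₂ : ℂ, ‖z₁‖ < r → ‖z₂‖ < r → ‖y₁‖ < r → ‖y₂‖ < r →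
    hermForm (A z₁ z₂) (D z₁ z₂) (B z₁ z₂) (y₁ - z₁) (y₂ - z₂)
      = hermForm (A y₁ y₂) (D y₁ y₂) (B y₁ y₂) (y₁ - z₁) (y₂ - z₂)

variable {r : ℝ} {A D : ℂ → ℂ → ℝ} {B : ℂ → ℂ → ℂ}

/-- Let `F_z` be the form at `z`, and `W = s w` with `s` small. Compare `F` at `ζ d` and at `±W` on
the differences `±W - ζ d`, and add. The mixed terms at `ζ d` cancel, and its `|ζ|²` term reduces to
`F_0(d)`. What remains is an expression for `F_{ζ d}(w)` that is quadratic in `ζ`; no regularity of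
the field is used. -/
theorem ConstOnLines.quadratic (hr : 0 < r) (h : ConstOnLines r A D B) (w₁ w₂ d₁ d₂ : ℂ)
    (hw₁ : ‖w₁‖ ≤ 1) (hw₂ : ‖w₂‖ ≤ 1) (hd₁ : ‖d₁‖ ≤ 1) (hd₂ : ‖d₂‖ ≤ 1) :
    ∃ (a c : ℝ) (b : ℂ), ∀ ζ : ℂ, ‖ζ‖ < r →
      hermForm (A (ζ * d₁) (ζ * d₂)) (D (ζ * d₁) (ζ * d₂)) (B (ζ * d₁) (ζ * d₂)) w₁ w₂
        = a + 2 * (b * ζ).re + c * Complex.normSq ζ := by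
  set s : ℝ := r / 2 with hs
  have hs0 : 0 < s := by positivity
  set W₁ : ℂ := s * w₁
  set W₂ : ℂ := s * w₂
  have hsn : ∀ w : ℂ, ‖w‖ ≤ 1 → ‖(s : ℂ) * w‖ < r := by
    intro w hw
    rw [norm_mul, Complex.norm_real, Real.norm_of_nonneg hs0.le]
    nlinarith
  have hW₁ : ‖W₁‖ < r := hsn _ hw₁
  have hW₂ : ‖W₂‖ < r := hsn _ hw₂
  have h00 : ‖(0 : ℂ)‖ < r := by simpa using hr
  set F : ℂ → ℂ → ℂ → ℂ → ℝ := fun z₁ z₂ => hermForm (A z₁ z₂) (D z₁ z₂) (B z₁ z₂) with hF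
  set P : ℂ → ℂ → ℂ := fun z₁ z₂ => hermPol (A z₁ z₂) (D z₁ z₂) (B z₁ z₂) W₁ W₂ d₁ d₂ with hP
  -- These coefficients come from solving that sum for `F_{ζ d}(W) = s² F_{ζ d}(w)`, using `F_W(W) =
  -- F_0(W) = F_{-W}(W)`.
  refine ⟨F 0 0 w₁ w₂, (F W₁ W₂ d₁ d₂ + F (-W₁) (-W₂) d₁ d₂ - 2 * F 0 0 d₁ d₂) / (2 * s ^ 2),
    ((1 / (2 * s ^ 2) : ℝ) : ℂ) * (P (-W₁) (-W₂) - P W₁ W₂), fun ζ hζ => ?_⟩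
  have hζd : ∀ d : ℂ, ‖d‖ ≤ 1 → ‖ζ * d‖ < r := by
    intro d hd
    rw [norm_mul]
    nlinarith [norm_nonneg ζ, norm_nonneg d]
  have e1 := h (ζ * d₁) (ζ * d₂) W₁ W₂ (hζd _ hd₁) (hζd _ hd₂) hW₁ hW₂
  have e2 := h (ζ * d₁) (ζ * d₂) (-W₁) (-W₂) (hζd _ hd₁) (hζd _ hd₂) (by simpa) (by simpa)
  have e3 := h 0 0 (ζ * d₁) (ζ * d₂) h00 h00 (hζd _ hd₁) (hζd _ hd₂)
  have e4 := h 0 0 W₁ W₂ h00 h00 hW₁ hW₂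
  have e5 := h (-W₁) (-W₂) 0 0 (by simpa) (by simpa) h00 h00
  rw [hermForm_sub, hermForm_sub] at e1
  rw [hermForm_neg_sub, hermForm_neg_sub] at e2
  rw [sub_zero, sub_zero, hermForm_smul, hermForm_smul] at e3
  rw [sub_zero, sub_zero] at e4
  rw [zero_sub, zero_sub, neg_neg, neg_neg] at e5
  have hsq : ∀ z₁ z₂, hermForm (A z₁ z₂) (D z₁ z₂) (B z₁ z₂) W₁ W₂ = s ^ 2 * F z₁ z₂ w₁ w₂ := by
    intro z₁ z₂
    rw [hermForm_smul, Complex.normSq_ofReal, pow_two]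
  rw [hsq, hsq] at e1 e2 e4 e5
  have hb : (((1 / (2 * s ^ 2) : ℝ) : ℂ) * (P (-W₁) (-W₂) - P W₁ W₂) * ζ).re
      = ((P (-W₁) (-W₂) * ζ).re - (P W₁ W₂ * ζ).re) / (2 * s ^ 2) := by
    rw [mul_assoc, Complex.re_ofReal_mul, sub_mul, Complex.sub_re]
    ring
  rw [hb]
  change F _ _ w₁ w₂ = _
  have hs2 : s ^ 2 ≠ 0 := by positivity
  field_simp
  rw [mul_comm ζ (P _ _), mul_comm ζ (P _ _)]
  simp only [hF, hP] at *
  linarith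

theorem ConstOnLines.eq_of_line (h : ConstOnLines r A D B) {z₁ z₂ y₁ y₂ w₁ w₂ μ : ℂ}
    (hz₁ : ‖z₁‖ < r) (hz₂ : ‖z₂‖ < r) (hy₁ : ‖y₁‖ < r) (hy₂ : ‖y₂‖ < r)
    (h₁ : y₁ - z₁ = μ * w₁) (h₂ : y₂ - z₂ = μ * w₂) :
    hermForm (A z₁ z₂) (D z₁ z₂) (B z₁ z₂) w₁ w₂
      = hermForm (A y₁ y₂) (D y₁ y₂) (B y₁ y₂) w₁ w₂ := by
  rcases eq_or_ne μ 0 with rfl | hμ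
  · rw [zero_mul, sub_eq_zero] at h₁ h₂
    rw [h₁, h₂]
  · have := h z₁ z₂ y₁ y₂ hz₁ hz₂ hy₁ hy₂
    rw [h₁, h₂, hermForm_smul, hermForm_smul] at this
    exact mul_left_cancel₀ (by simpa using hμ) this

/-- Nine evaluations, with each variable in `{0, ±t, i t}`, separate all the real coefficients. -/
theorem coeff_eq_zero {ρ : ℝ} (hρ : 0 < ρ) {α γ γ' : ℝ} {β β' κ : ℂ}
    (h : ∀ z₁ z₂ : ℂ, ‖z₁‖ < ρ → ‖z₂‖ < ρ → α + 2 * (β * z₁ + β' * z₂).re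
      + γ * Complex.normSq z₁ + γ' * Complex.normSq z₂ + 2 * (κ * z₁ * star z₂).re = 0) :
    α = 0 ∧ β = 0 ∧ β' = 0 ∧ γ = 0 ∧ γ' = 0 ∧ κ = 0 := by
  set t : ℝ := ρ / 2
  have ht : 0 < t := by positivity
  have n0 : ‖(0 : ℂ)‖ < ρ := by simpa using hρ
  have n1 : ‖(t : ℂ)‖ < ρ := by
    rw [Complex.norm_real, Real.norm_of_nonneg ht.le]; exact half_lt_self hρ
  have n2 : ‖-(t : ℂ)‖ < ρ := by rwa [norm_neg]
  have n3 : ‖(t : ℂ) * Complex.I‖ < ρ := by simpa using n1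
  have n4 : ‖-((t : ℂ) * Complex.I)‖ < ρ := by rwa [norm_neg]
  have e0 := h 0 0 n0 n0
  have e1 := h _ _ n1 n0
  have e2 := h _ _ n2 n0
  have e3 := h _ _ n3 n0
  have e4 := h _ _ n0 n1
  have e5 := h _ _ n0 n2
  have e6 := h _ _ n0 n3
  have e7 := h _ _ n1 n1
  have e8 := h _ _ n3 n1
  simp [Complex.normSq_apply] at e0 e1 e2 e3 e4 e5 e6 e7 e8
  have hα : α = 0 := e0
  subst hα
  have hγ : γ = 0 := by
    have : γ * (t * t) = 0 := by linarith
    simpa [ht.ne'] using this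
  have hγ' : γ' = 0 := by
    have : γ' * (t * t) = 0 := by linarith
    simpa [ht.ne'] using this
  subst hγ hγ'
  have hβr : β.re = 0 := by
    have : β.re * t = 0 := by linarith
    simpa [ht.ne'] using this
  have hβi : β.im = 0 := by
    have : β.im * t = 0 := by linarith
    simpa [ht.ne'] using this
  have hβr' : β'.re = 0 := by
    have : β'.re * t = 0 := by linarith
    simpa [ht.ne'] using this
  have hβi' : β'.im = 0 := by
    have : β'.im * t = 0 := by linarith
    simpa [ht.ne'] using this
  have hκr : κ.re = 0 := by
    rw [hβr, hβr'] at e7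
    have : κ.re * t * t = 0 := by linarith
    simpa [ht.ne'] using this
  have hκi : κ.im = 0 := by
    rw [hβr', hβi] at e8
    have : κ.im * t * t = 0 := by linarith
    simpa [ht.ne'] using this
  exact ⟨rfl, Complex.ext hβr hβi, Complex.ext hβr' hβi', rfl, rfl, Complex.ext hκr hκi⟩

/-- The value on `(1, ±l)` is constant along lines in that direction, hence a function of `z₂ ∓ l
z₁`, quadratic by `ConstOnLines.quadratic`. The sum of the two values eliminates `B` and fixes the
quadratic and linear coefficients; one value alone then yields `Re(conj(l) B)`. The radius is halved
so that `z₂ ∓ l z₁` stays within `r`. -/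
theorem ConstOnLines.offDiag (hr : 0 < r) (h : ConstOnLines r A D B) {a c a' c' : ℝ} {b b' : ℂ}
    (hA : ∀ z₁ z₂, ‖z₁‖ < r → ‖z₂‖ < r → A z₁ z₂ = a + 2 * (b * z₂).re + c * Complex.normSq z₂)
    (hD : ∀ z₁ z₂, ‖z₁‖ < r → ‖z₂‖ < r → D z₁ z₂ = a' + 2 * (b' * z₁).re + c' * Complex.normSq z₁)
    {l : ℂ} (hl : Complex.normSq l = 1) :
    c' = c ∧ ∃ m : ℝ, ∀ z₁ z₂, ‖z₁‖ < r / 2 → ‖z₂‖ < r / 2 →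
      (star l * B z₁ z₂).re
        = m + (star l * (-(star b * star z₁) - b' * z₂ - c * z₂ * star z₁)).re := by
  have hln : ‖l‖ = 1 := by
    rw [← Complex.sq_norm] at hl
    exact (pow_eq_one_iff_of_nonneg (norm_nonneg _) two_ne_zero).1 hl
  have hl0 : l ≠ 0 := by
    rintro rfl
    simp at hl
  obtain ⟨a₁, c₁, b₁, h₁⟩ := h.quadratic hr 1 l 0 1 (by simp) hln.le (by simp) (by simp)
  obtain ⟨a₂, c₂, b₂, h₂⟩ := h.quadratic hr 1 (-l) 0 1 (by simp) (by simp [hln]) (by simp)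
    (by simp)
  simp only [mul_zero, mul_one] at h₁ h₂
  have hsmall : ∀ {z : ℂ}, ‖z‖ < r / 2 → ‖z‖ < r := fun hz => by linarith
  have h00 : ‖(0 : ℂ)‖ < r := by simpa using hr
  have f₁ : ∀ z₁ z₂, ‖z₁‖ < r / 2 → ‖z₂‖ < r / 2 →
      hermForm (A z₁ z₂) (D z₁ z₂) (B z₁ z₂) 1 l
        = a₁ + 2 * (b₁ * (z₂ - l * z₁)).re + c₁ * Complex.normSq (z₂ - l * z₁) := by
    intro z₁ z₂ hz₁ hz₂
    have hn : ‖z₂ - l * z₁‖ < r := by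
      refine (norm_sub_le _ _).trans_lt ?_
      rw [norm_mul, hln]
      linarith
    rw [← h₁ _ hn]
    exact (h.eq_of_line (μ := z₁) h00 hn (hsmall hz₁) (hsmall hz₂) (by ring) (by ring)).symm
  have f₂ : ∀ z₁ z₂, ‖z₁‖ < r / 2 → ‖z₂‖ < r / 2 →
      hermForm (A z₁ z₂) (D z₁ z₂) (B z₁ z₂) 1 (-l)
        = a₂ + 2 * (b₂ * (z₂ + l * z₁)).re + c₂ * Complex.normSq (z₂ + l * z₁) := by
    intro z₁ z₂ hz₁ hz₂
    have hn : ‖z₂ + l * z₁‖ < r := by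
      refine (norm_add_le _ _).trans_lt ?_
      rw [norm_mul, hln]
      linarith
    rw [← h₂ _ hn]
    exact (h.eq_of_line (μ := z₁) h00 hn (hsmall hz₁) (hsmall hz₂) (by ring) (by ring)).symm
  have hl' : l.re * l.re + l.im * l.im = 1 := by rw [← Complex.normSq_apply, hl]
  -- Since `|l| = 1`, the two values add up to `2A + 2D`, so this compares coefficients of
  -- polynomials in `z₁, z₂`.
  obtain ⟨-, hβ, hβ', hγ, hγ', hκ⟩ := coeff_eq_zero (half_pos hr)
    (α := a₁ + a₂ - 2 * a - 2 * a') (β := -(l * b₁) + l * b₂ - 2 * b') (β' := b₁ + b₂ - 2 * b)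
    (γ := c₁ + c₂ - 2 * c') (γ' := c₁ + c₂ - 2 * c) (κ := -(l * c₁) + l * c₂) (by
      intro z₁ z₂ hz₁ hz₂
      have g₁ := f₁ z₁ z₂ hz₁ hz₂
      have g₂ := f₂ z₁ z₂ hz₁ hz₂
      rw [hA _ _ (hsmall hz₁) (hsmall hz₂), hD _ _ (hsmall hz₁) (hsmall hz₂)] at g₁ g₂
      simp only [hermForm, Complex.normSq_apply, Complex.mul_re, Complex.mul_im, Complex.star_def,
        Complex.conj_re, Complex.conj_im, Complex.sub_re, Complex.sub_im, Complex.add_re,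
        Complex.add_im, Complex.ofReal_re, Complex.ofReal_im, Complex.neg_re, Complex.neg_im,
        Complex.one_re, Complex.one_im, Complex.re_ofNat, Complex.im_ofNat] at g₁ g₂ ⊢
      linear_combination -g₁ - g₂ + (2 * (a' + 2 * (b'.re * z₁.re - b'.im * z₁.im)
        + c' * (z₁.re * z₁.re + z₁.im * z₁.im))
        - (c₁ + c₂) * (z₁.re * z₁.re + z₁.im * z₁.im)) * hl')
  have hc : c' = c := by linarith
  have hc₁ : c₁ = c := by
    have h1 : l * ((c₂ : ℂ) - c₁) = 0 := by linear_combination hκ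
    have h2 : (c₂ : ℂ) - c₁ = 0 := (mul_eq_zero.1 h1).resolve_left hl0
    have h3 : c₂ - c₁ = 0 := by exact_mod_cast h2
    linarith
  have hb₁ : l * b₁ = l * b - b' := by linear_combination (-1 / 2 : ℂ) * hβ + l / 2 * hβ'
  have hb₁' : b₁ = b - star l * b' := by
    have hll : star l * l = 1 := by
      rw [Complex.star_def, ← Complex.normSq_eq_conj_mul_self, hl, Complex.ofReal_one]
    linear_combination star l * hb₁ + (b - b₁) * hll
  refine ⟨hc, (a₁ - a - a') / 2, fun z₁ z₂ hz₁ hz₂ => ?_⟩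
  have g₁ := f₁ z₁ z₂ hz₁ hz₂
  rw [hA _ _ (hsmall hz₁) (hsmall hz₂), hD _ _ (hsmall hz₁) (hsmall hz₂), hb₁', hc₁, hc] at g₁
  simp only [hermForm, Complex.normSq_apply, Complex.mul_re, Complex.mul_im, Complex.star_def,
    Complex.conj_re, Complex.conj_im, Complex.sub_re, Complex.sub_im, Complex.ofReal_re,
    Complex.ofReal_im, Complex.neg_re, Complex.neg_im, Complex.one_re, Complex.one_im] at g₁ ⊢
  linear_combination g₁ / 2 - hl' * (a' / 2)

/-- A field of hermitian forms on a polydisc that is constant along complex lines is the restriction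
of a hermitian form in three variables. -/
theorem ConstOnLines.eq_polynomial (hr : 0 < r) (h : ConstOnLines r A D B) :
    ∃ (a a' c : ℝ) (b b' n : ℂ), ∀ z₁ z₂, ‖z₁‖ < r / 2 → ‖z₂‖ < r / 2 →
      A z₁ z₂ = a + 2 * (b * z₂).re + c * Complex.normSq z₂ ∧
      D z₁ z₂ = a' + 2 * (b' * z₁).re + c * Complex.normSq z₁ ∧
      B z₁ z₂ = n - star b * star z₁ - b' * z₂ - c * z₂ * star z₁ := by
  have h00 : ‖(0 : ℂ)‖ < r := by simpa using hr
  obtain ⟨a, c, b, h₁⟩ := h.quadratic hr 1 0 0 1 (by simp) (by simp) (by simp) (by simp)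
  obtain ⟨a', c', b', h₂⟩ := h.quadratic hr 0 1 1 0 (by simp) (by simp) (by simp) (by simp)
  have hA : ∀ z₁ z₂, ‖z₁‖ < r → ‖z₂‖ < r →
      A z₁ z₂ = a + 2 * (b * z₂).re + c * Complex.normSq z₂ := by
    intro z₁ z₂ hz₁ hz₂
    rw [← h₁ z₂ hz₂, mul_zero, mul_one, h.eq_of_line (μ := z₁) (y₁ := z₁) (y₂ := z₂) h00 hz₂ hz₁ hz₂
      (by ring) (by ring)]
    simp [hermForm]
  have hD : ∀ z₁ z₂, ‖z₁‖ < r → ‖z₂‖ < r →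
      D z₁ z₂ = a' + 2 * (b' * z₁).re + c' * Complex.normSq z₁ := by
    intro z₁ z₂ hz₁ hz₂
    rw [← h₂ z₁ hz₁, mul_zero, mul_one, h.eq_of_line (μ := z₂) (y₁ := z₁) (y₂ := z₂) hz₁ h00 hz₁ hz₂
      (by ring) (by ring)]
    simp [hermForm]
  -- The choice `l = 1` gives the real part of `B`, and `l = i` its imaginary part.
  obtain ⟨hc, m, hm⟩ := h.offDiag hr hA hD (l := 1) (by simp)
  obtain ⟨-, m', hm'⟩ := h.offDiag hr hA hD (l := Complex.I) (by simp)
  refine ⟨a, a', c, b, b', ⟨m, m'⟩, fun z₁ z₂ hz₁ hz₂ =>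
    ⟨hA _ _ (by linarith) (by linarith), hc ▸ hD _ _ (by linarith) (by linarith), ?_⟩⟩
  have g := hm z₁ z₂ hz₁ hz₂
  have g' := hm' z₁ z₂ hz₁ hz₂
  apply Complex.ext
  · simp at g ⊢
    linarith
  · simp at g' ⊢
    linarith

end Rigidity

section LeviCivita

/-! ### The Levi-Civita connection of a compatible metric -/

section Metric

variable {g : BilinField} {U : Set CP2} {k : Fin 3} {z : C2}

theorem IsPseudoKahler.differentiableAt (hg : IsPseudoKahler g U) (hU : IsOpen U)
    (hz : z ∈ coordDomain U k) (w y : C2) :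
    DifferentiableAt ℝ (fun x => g.inChart k x w y) z :=
  ((hg.smooth k w y).contDiffAt ((isOpen_coordDomain hU k).mem_nhds hz)).differentiableAt (by simp)

theorem IsPseudoKahler.inChart_symm (hg : IsPseudoKahler g U) (hz : z ∈ coordDomain U k)
    (u w : C2) : g.inChart k z u w = g.inChart k z w u := hg.symm _ hz _ _

theorem IsPseudoKahler.inChart_nondeg (hg : IsPseudoKahler g U) (hz : z ∈ coordDomain U k)
    (u : C2) (hu : ∀ w, g.inChart k z u w = 0) : u = 0 :=
  inChart_nondegenerate hg.nondegenerate hz u hu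

theorem IsPseudoKahler.inChart_I_I (hg : IsPseudoKahler g U) (hz : z ∈ coordDomain U k)
    (u w : C2) : g.inChart k z (Complex.I • u) (Complex.I • w) = g.inChart k z u w :=
  CProj.inChart_I_I hg.hermitian hz u w

/-- The expression of `g` in a chart as a bilinear form. -/
def chartForm (g : BilinField) (k : Fin 3) (z : C2) : LinearMap.BilinForm ℝ C2 :=
  LinearMap.mk₂ ℝ (g.inChart k z) (inChart_add_left g k z) (inChart_smul_left g k z)
    (inChart_add_right g k z) (inChart_smul_right g k z)

/-- The derivative of `g` in a chart. -/
def chartDeriv (g : BilinField) (k : Fin 3) (z u w y : C2) : ℝ :=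
  fderiv ℝ (fun x => g.inChart k x w y) z u

theorem IsPseudoKahler.chartDeriv_add (hg : IsPseudoKahler g U) (hU : IsOpen U)
    (hz : z ∈ coordDomain U k) (u w y y' : C2) :
    chartDeriv g k z u w (y + y') = chartDeriv g k z u w y + chartDeriv g k z u w y' := by
  simp only [chartDeriv, inChart_add_right]
  rw [fderiv_fun_add (hg.differentiableAt hU hz w y) (hg.differentiableAt hU hz w y')]
  rfl

theorem IsPseudoKahler.chartDeriv_smul (hg : IsPseudoKahler g U) (hU : IsOpen U)
    (hz : z ∈ coordDomain U k) (c : ℝ) (u w y : C2) :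
    chartDeriv g k z u w (c • y) = c * chartDeriv g k z u w y := by
  simp only [chartDeriv, inChart_smul_right]
  rw [fderiv_const_mul (hg.differentiableAt hU hz w y)]
  rfl

theorem IsPseudoKahler.chartDeriv_symm (hg : IsPseudoKahler g U) (hU : IsOpen U)
    (hz : z ∈ coordDomain U k) (u w y : C2) :
    chartDeriv g k z u w y = chartDeriv g k z u y w := by
  have : (fun x => g.inChart k x w y) =ᶠ[nhds z] fun x => g.inChart k x y w := by
    filter_upwards [(isOpen_coordDomain hU k).mem_nhds hz] with x hx
    exact hg.inChart_symm hx w y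
  rw [chartDeriv, chartDeriv, this.fderiv_eq]

theorem isKoszul_iff (g : BilinField) (k : Fin 3) (z u w a : C2) :
    IsKoszul g k z u w a ↔ ∀ y, g.inChart k z a y
      = (chartDeriv g k z u w y + chartDeriv g k z w u y - chartDeriv g k z y u w) / 2 := Iff.rfl

/-- The right-hand side of the Koszul formula is linear in `y`, and a nondegenerate form on a
finite-dimensional space represents every functional. Hence a solution exists for `epsilon` to
choose. -/
theorem IsPseudoKahler.isKoszul_leviCivita (hg : IsPseudoKahler g U) (hU : IsOpen U)
    (hz : z ∈ coordDomain U k) (u w : C2) :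
    IsKoszul g k z u w (leviCivita g k z u w) := by
  let ℓ : Module.Dual ℝ C2 :=
    { toFun := fun y =>
        (chartDeriv g k z u w y + chartDeriv g k z w u y - chartDeriv g k z y u w) / 2
      map_add' := fun y y' => by
        rw [hg.chartDeriv_add hU hz, hg.chartDeriv_add hU hz]
        have : chartDeriv g k z (y + y') u w = chartDeriv g k z y u w + chartDeriv g k z y' u w :=
          map_add _ _ _
        rw [this]
        ring
      map_smul' := fun c y => by
        rw [hg.chartDeriv_smul hU hz, hg.chartDeriv_smul hU hz]
        have : chartDeriv g k z (c • y) u w = c * chartDeriv g k z y u w := map_smul _ _ _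
        rw [this, RingHom.id_apply, smul_eq_mul]
        ring }
  have hinj : Function.Injective (chartForm g k z) := by
    refine (injective_iff_map_eq_zero _).2 fun a ha => hg.inChart_nondeg hz a fun y => ?_
    exact LinearMap.congr_fun ha y
  have hsurj : Function.Surjective (chartForm g k z) :=
    (LinearMap.injective_iff_surjective_of_finrank_eq_finrank Subspace.dual_finrank_eq.symm).1 hinj
  obtain ⟨a, ha⟩ := hsurj ℓ
  have hex : ∃ a, IsKoszul g k z u w a := ⟨a, fun y => LinearMap.congr_fun ha y⟩
  exact Classical.epsilon_spec hex

theorem IsPseudoKahler.eq_of_isKoszul (hg : IsPseudoKahler g U)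
    (hz : z ∈ coordDomain U k) {u w a : C2} (ha : IsKoszul g k z u w a) :
    leviCivita g k z u w = a :=
  leviCivita_eq (hg.inChart_nondeg hz) ha

/-- The Levi-Civita connection is metric. -/
theorem IsPseudoKahler.chartDeriv_eq (hg : IsPseudoKahler g U) (hU : IsOpen U)
    (hz : z ∈ coordDomain U k) (u w y : C2) :
    chartDeriv g k z u w y = g.inChart k z (leviCivita g k z u w) y
      + g.inChart k z w (leviCivita g k z u y) := by
  have h1 := (isKoszul_iff ..).1 (hg.isKoszul_leviCivita hU hz u w) y
  have h2 := (isKoszul_iff ..).1 (hg.isKoszul_leviCivita hU hz u y) w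
  rw [hg.inChart_symm hz w, h1, h2, hg.chartDeriv_symm hU hz u y w]
  ring

theorem IsPseudoKahler.leviCivita_symm (hg : IsPseudoKahler g U) (hU : IsOpen U)
    (hz : z ∈ coordDomain U k) (u w : C2) : leviCivita g k z u w = leviCivita g k z w u := by
  refine hg.eq_of_isKoszul hz ((isKoszul_iff ..).2 fun y => ?_)
  rw [(isKoszul_iff ..).1 (hg.isKoszul_leviCivita hU hz w u) y, hg.chartDeriv_symm hU hz y u w]
  ring

theorem IsPseudoKahler.leviCivita_add (hg : IsPseudoKahler g U) (hU : IsOpen U)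
    (hz : z ∈ coordDomain U k) (u w w' : C2) :
    leviCivita g k z u (w + w') = leviCivita g k z u w + leviCivita g k z u w' := by
  refine hg.eq_of_isKoszul hz ((isKoszul_iff ..).2 fun y => ?_)
  rw [inChart_add_left, (isKoszul_iff ..).1 (hg.isKoszul_leviCivita hU hz u w) y,
    (isKoszul_iff ..).1 (hg.isKoszul_leviCivita hU hz u w') y, hg.chartDeriv_add hU hz y,
    hg.chartDeriv_symm hU hz u (w + w'), hg.chartDeriv_add hU hz, hg.chartDeriv_symm hU hz u w,
    hg.chartDeriv_symm hU hz u w']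
  have : chartDeriv g k z (w + w') u y = chartDeriv g k z w u y + chartDeriv g k z w' u y :=
    map_add _ _ _
  rw [this]
  ring

theorem IsPseudoKahler.leviCivita_real_smul (hg : IsPseudoKahler g U) (hU : IsOpen U)
    (hz : z ∈ coordDomain U k) (c : ℝ) (u w : C2) :
    leviCivita g k z u (c • w) = c • leviCivita g k z u w := by
  refine hg.eq_of_isKoszul hz ((isKoszul_iff ..).2 fun y => ?_)
  rw [inChart_smul_left, (isKoszul_iff ..).1 (hg.isKoszul_leviCivita hU hz u w) y,
    hg.chartDeriv_smul hU hz, hg.chartDeriv_symm hU hz u (c • w), hg.chartDeriv_smul hU hz,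
    hg.chartDeriv_symm hU hz u w]
  have : chartDeriv g k z (c • w) u y = c * chartDeriv g k z w u y := map_smul _ _ _
  rw [this]
  ring

theorem complex_smul_eq (c : ℂ) (w : C2) : c • w = c.re • w + c.im • Complex.I • w := by
  ext i
  simp only [Pi.add_apply, Pi.smul_apply, smul_eq_mul, Complex.real_smul]
  conv_lhs => rw [← Complex.re_add_im c]
  ring

theorem IsPseudoKahler.leviCivita_smul (hg : IsPseudoKahler g U) (hU : IsOpen U)
    (hz : z ∈ coordDomain U k) (c : ℂ) (u w : C2) :
    leviCivita g k z u (c • w) = c • leviCivita g k z u w := by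
  rw [complex_smul_eq, hg.leviCivita_add hU hz, hg.leviCivita_real_smul hU hz,
    hg.leviCivita_real_smul hU hz, hg.parallel k z hz, ← complex_smul_eq]

end Metric

/-- A symmetric bilinear map `Γ` on `ℂ²` for which `Γ(u, u)` is always a multiple of `u` has the form
`Γ(u, w) = φ(u) w + φ(w) u` with a linear form `φ`. -/
theorem exists_linear_form {Γ : C2 → C2 → C2} (hsymm : ∀ u w, Γ u w = Γ w u)
    (hadd : ∀ u w w', Γ u (w + w') = Γ u w + Γ u w')
    (hsmul : ∀ (c : ℂ) u w, Γ u (c • w) = c • Γ u w)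
    (hplanar : ∀ u, u ≠ 0 → ∃ c : ℂ, Γ u u = c • u) :
    ∃ a b : ℂ, ∀ u w, Γ u w = (a * u 0 + b * u 1) • w + (a * w 0 + b * w 1) • u := by
  have hne : ∀ s : ℂ, e₁ + s • e₂ ≠ 0 := fun s h => by
    simpa using congrFun h 0
  have hadd' : ∀ u u' w, Γ (u + u') w = Γ u w + Γ u' w := fun u u' w => by
    rw [hsymm, hadd, hsymm w, hsymm w]
  have hsmul' : ∀ (c : ℂ) u w, Γ (c • u) w = c • Γ u w := fun c u w => by
    rw [hsymm, hsmul, hsymm w]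
  obtain ⟨α, hα⟩ := hplanar e₁ (by simpa using hne 0)
  obtain ⟨β, hβ⟩ := hplanar e₂ fun h => by simpa using congrFun h 1
  -- Eliminating `c` and `d` from the conditions on `e₁ ± e₂` leaves two linear equations that
  -- determine both components of `Γ(e₁, e₂)`.
  obtain ⟨c, hc⟩ := hplanar _ (hne 1)
  obtain ⟨d, hd⟩ := hplanar _ (hne (-1))
  rw [hadd, hadd', hadd', hsmul', hsmul', hsmul, hsmul, hα, hβ, hsymm e₂ e₁] at hc hd
  have hc0 := congrFun hc 0
  have hc1 := congrFun hc 1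
  have hd0 := congrFun hd 0
  have hd1 := congrFun hd 1
  simp at hc0 hc1 hd0 hd1
  have h12 : Γ e₁ e₂ = (β / 2) • e₁ + (α / 2) • e₂ := by
    ext i
    fin_cases i
    · simp
      linear_combination (1 / 4 : ℂ) * hc0 - (1 / 4 : ℂ) * hd0 - (1 / 4 : ℂ) * hc1
        - (1 / 4 : ℂ) * hd1
    · simp
      linear_combination (1 / 4 : ℂ) * hc1 - (1 / 4 : ℂ) * hd1 - (1 / 4 : ℂ) * hc0
        - (1 / 4 : ℂ) * hd0
  refine ⟨α / 2, β / 2, fun u w => ?_⟩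
  rw [eq_smul_e u, eq_smul_e w]
  simp only [hadd, hadd', hsmul, hsmul', hα, hβ, hsymm e₂ e₁, h12]
  ext i
  fin_cases i <;> simp <;> ring

end LeviCivita

section Weight

/-! ### Compatible metrics are constant along lines up to a weight -/

/-- The hermitian form with the real part `g` in an affine chart. -/
def chartHerm (g : BilinField) (k : Fin 3) (z w y : C2) : ℂ :=
  ⟨g.inChart k z w y, g.inChart k z w (Complex.I • y)⟩

/-- The determinant of the hermitian form of `g` in an affine chart. -/
def chartDet (g : BilinField) (k : Fin 3) (z : C2) : ℂ :=
  chartHerm g k z e₁ e₁ * chartHerm g k z e₂ e₂ - chartHerm g k z e₁ e₂ * chartHerm g k z e₂ e₁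

section Herm

variable {g : BilinField} {U : Set CP2} {k : Fin 3} {z : C2}

theorem chartHerm_add_left (u u' w : C2) :
    chartHerm g k z (u + u') w = chartHerm g k z u w + chartHerm g k z u' w := by
  apply Complex.ext <;> simp [chartHerm, inChart_add_left]

theorem chartHerm_add_right (u w w' : C2) :
    chartHerm g k z u (w + w') = chartHerm g k z u w + chartHerm g k z u w' := by
  apply Complex.ext <;> simp [chartHerm, inChart_add_right]

theorem inChart_neg_left (u w : C2) : g.inChart k z (-u) w = -g.inChart k z u w := by
  simpa using inChart_smul_left g k z (-1) u w

theorem I_smul_I_smul (w : C2) : Complex.I • Complex.I • w = -w := by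
  rw [smul_smul, Complex.I_mul_I, neg_one_smul]

theorem IsPseudoKahler.inChart_I_left (hg : IsPseudoKahler g U)
    (hz : z ∈ coordDomain U k) (u w : C2) :
    g.inChart k z (Complex.I • u) w = -g.inChart k z u (Complex.I • w) := by
  rw [← hg.inChart_I_I hz, I_smul_I_smul, inChart_neg_left]

theorem IsPseudoKahler.star_chartHerm (hg : IsPseudoKahler g U)
    (hz : z ∈ coordDomain U k) (u w : C2) :
    star (chartHerm g k z u w) = chartHerm g k z w u := by
  apply Complex.ext
  · simp [chartHerm, hg.inChart_symm hz u w]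
  · simp [chartHerm, hg.inChart_symm hz w, hg.inChart_I_left hz]

theorem IsPseudoKahler.chartHerm_smul_left (hg : IsPseudoKahler g U)
    (hz : z ∈ coordDomain U k) (c : ℂ) (u w : C2) :
    chartHerm g k z (c • u) w = c * chartHerm g k z u w := by
  rw [complex_smul_eq]
  apply Complex.ext
  · simp [chartHerm, inChart_add_left, inChart_smul_left, hg.inChart_I_left hz]
    ring
  · simp [chartHerm, inChart_add_left, inChart_smul_left, hg.inChart_I_I hz]

theorem IsPseudoKahler.chartHerm_smul_right (hg : IsPseudoKahler g U)
    (hz : z ∈ coordDomain U k) (c : ℂ) (u w : C2) :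
    chartHerm g k z u (c • w) = star c * chartHerm g k z u w := by
  rw [← hg.star_chartHerm hz, hg.chartHerm_smul_left hz, star_mul', hg.star_chartHerm hz]

/-- A left null vector of the Gram matrix would be orthogonal to everything. -/
theorem IsPseudoKahler.chartDet_ne_zero (hg : IsPseudoKahler g U)
    (hz : z ∈ coordDomain U k) : chartDet g k z ≠ 0 := by
  intro h
  have hdet : Matrix.det !![chartHerm g k z e₁ e₁, chartHerm g k z e₁ e₂;
      chartHerm g k z e₂ e₁, chartHerm g k z e₂ e₂] = 0 := by
    rw [Matrix.det_fin_two_of]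
    exact h
  obtain ⟨v, hv, hM⟩ := Matrix.exists_vecMul_eq_zero_iff.2 hdet
  have h1 := congrFun hM 0
  have h2 := congrFun hM 1
  simp [Matrix.vecMul, dotProduct, Fin.sum_univ_two] at h1 h2
  have hH : ∀ w, chartHerm g k z v w = 0 := by
    intro w
    rw [eq_smul_e v, eq_smul_e w]
    simp only [chartHerm_add_left, chartHerm_add_right, hg.chartHerm_smul_left hz,
      hg.chartHerm_smul_right hz]
    linear_combination star (w 0) * h1 + star (w 1) * h2
  exact hv (hg.inChart_nondeg hz v fun w => congrArg Complex.re (hH w))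

theorem IsPseudoKahler.ofReal_re_chartDet (hg : IsPseudoKahler g U)
    (hz : z ∈ coordDomain U k) : ((chartDet g k z).re : ℂ) = chartDet g k z := by
  refine Complex.conj_eq_iff_re.1 ?_
  rw [← Complex.star_def, chartDet, star_sub, star_mul', star_mul', hg.star_chartHerm hz,
    hg.star_chartHerm hz, hg.star_chartHerm hz, hg.star_chartHerm hz]
  ring

theorem IsPseudoKahler.ofReal_inChart_self (hg : IsPseudoKahler g U)
    (hz : z ∈ coordDomain U k) (u : C2) :
    (g.inChart k z u u : ℂ) = chartHerm g k z u u :=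
  Complex.conj_eq_iff_re.1 (hg.star_chartHerm hz u u)

end Herm

/-! ### Derivatives along lines -/

section Lines

variable {g : BilinField} {U : Set CP2} {k : Fin 3}

theorem IsPseudoKahler.hasDerivAt_inChart (hg : IsPseudoKahler g U) (hU : IsOpen U) {z u : C2}
    {t : ℝ} (hz : z + t • u ∈ coordDomain U k) (w y : C2) :
    HasDerivAt (fun s : ℝ => g.inChart k (z + s • u) w y) (chartDeriv g k (z + t • u) u w y) t := by
  have hline : HasDerivAt (fun t : ℝ => z + t • u) u t := by
    simpa using ((hasDerivAt_id t).smul_const u).const_add z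
  exact (hg.differentiableAt hU hz w y).hasFDerivAt.comp_hasDerivAt t hline

/-- The covariant derivative of the hermitian form along a line. -/
theorem hasDerivAt_chartHerm (hg : IsPseudoKahler g U) (hU : IsOpen U) {z u : C2}
    {t : ℝ} (hz : z + t • u ∈ coordDomain U k) {a b : ℂ}
    (hΓ : ∀ v w, leviCivita g k (z + t • u) v w
      = (a * v 0 + b * v 1) • w + (a * w 0 + b * w 1) • v) (w y : C2) :
    HasDerivAt (fun s : ℝ => chartHerm g k (z + s • u) w y)
      ((a * u 0 + b * u 1 + star (a * u 0 + b * u 1)) * chartHerm g k (z + t • u) w y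
        + (a * w 0 + b * w 1) * chartHerm g k (z + t • u) u y
        + star (a * y 0 + b * y 1) * chartHerm g k (z + t • u) w u) t := by
  have h1 := (hg.hasDerivAt_inChart hU hz w y).ofReal_comp
  have h2 := (hg.hasDerivAt_inChart hU hz w (Complex.I • y)).ofReal_comp
  have h3 := h1.add (h2.mul_const Complex.I)
  have hfun : (fun s : ℝ => chartHerm g k (z + s • u) w y) =
      (fun s : ℝ => ((g.inChart k (z + s • u) w y : ℝ) : ℂ))
        + fun s : ℝ => ((g.inChart k (z + s • u) w (Complex.I • y) : ℝ) : ℂ) * Complex.I := by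
    ext s
    exact (Complex.re_add_im (chartHerm g k (z + s • u) w y)).symm
  rw [hfun]
  refine h3.congr_deriv ?_
  rw [hg.chartDeriv_eq hU hz, hg.chartDeriv_eq hU hz, hg.leviCivita_smul hU hz]
  have h4 : ∀ p q p' q' : ℝ, ((p + q : ℝ) : ℂ) + ((p' + q' : ℝ) : ℂ) * Complex.I
      = (⟨p, p'⟩ : ℂ) + ⟨q, q'⟩ := by
    intro p q p' q'
    apply Complex.ext <;> simp
  rw [h4]
  change chartHerm g k (z + t • u) (leviCivita g k (z + t • u) u w) y
    + chartHerm g k (z + t • u) w (leviCivita g k (z + t • u) u y) = _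
  rw [hΓ, hΓ]
  simp only [chartHerm_add_left, chartHerm_add_right, hg.chartHerm_smul_left hz,
    hg.chartHerm_smul_right hz]
  ring

theorem hasDerivAt_chartDet (hg : IsPseudoKahler g U) (hU : IsOpen U) {z u : C2}
    {t : ℝ} (hz : z + t • u ∈ coordDomain U k) {a b : ℂ}
    (hΓ : ∀ v w, leviCivita g k (z + t • u) v w
      = (a * v 0 + b * v 1) • w + (a * w 0 + b * w 1) • v) :
    HasDerivAt (fun s : ℝ => chartDet g k (z + s • u))
      (3 * (a * u 0 + b * u 1 + star (a * u 0 + b * u 1)) * chartDet g k (z + t • u)) t := by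
  have h := hasDerivAt_chartHerm hg hU hz hΓ
  refine (((h e₁ e₁).mul (h e₂ e₂)).sub ((h e₁ e₂).mul (h e₂ e₁))).congr_deriv ?_
  have hl : ∀ y, chartHerm g k (z + t • u) u y
      = u 0 * chartHerm g k (z + t • u) e₁ y + u 1 * chartHerm g k (z + t • u) e₂ y := by
    intro y
    refine (congrArg (fun v => chartHerm g k (z + t • u) v y) (eq_smul_e u)).trans ?_
    rw [chartHerm_add_left, hg.chartHerm_smul_left hz, hg.chartHerm_smul_left hz]
  have hr : ∀ y, chartHerm g k (z + t • u) y u = star (u 0) * chartHerm g k (z + t • u) y e₁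
      + star (u 1) * chartHerm g k (z + t • u) y e₂ := by
    intro y
    rw [← hg.star_chartHerm hz, hl, star_add, star_mul', star_mul', hg.star_chartHerm hz,
      hg.star_chartHerm hz]
  simp only [hl, hr, e₁_zero, e₁_one, e₂_zero, e₂_one, chartDet, star_add, star_mul', star_one,
    star_zero]
  ring

/-- Along a line with the direction `u`, `g(u, u)³ / det(g)²` is constant. -/
theorem inChart_cube_eq (hg : IsPseudoKahler g U) (hU : IsOpen U)
    (hp : IsPlanar (leviCivita g) U) {s : Set C2} (hs : Convex ℝ s) (hsU : s ⊆ coordDomain U k)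
    {z y : C2} (hz : z ∈ s) (hy : y ∈ s) :
    chartHerm g k y (y - z) (y - z) ^ 3 / chartDet g k y ^ 2
      = chartHerm g k z (y - z) (y - z) ^ 3 / chartDet g k z ^ 2 := by
  set u := y - z with hu
  have hmem : ∀ t ∈ Set.Icc (0 : ℝ) 1, z + t • u ∈ coordDomain U k := fun t ht =>
    hsU (hs.add_smul_sub_mem hz hy ht)
  have hder : ∀ t ∈ Set.Icc (0 : ℝ) 1, HasDerivAt (fun t : ℝ =>
      chartHerm g k (z + t • u) u u ^ 3 / chartDet g k (z + t • u) ^ 2) 0 t := by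
    intro t ht
    have hzt := hmem t ht
    -- The linear form may vary with `t` in any manner: the derivative of the quotient vanishes at
    -- each `t` separately, both logarithmic derivatives being `6(φ(u) + conj φ(u))`.
    obtain ⟨a, b, hΓ⟩ := exists_linear_form (hg.leviCivita_symm hU hzt)
      (hg.leviCivita_add hU hzt) (hg.leviCivita_smul hU hzt) (hp k _ hzt)
    have hδ := hg.chartDet_ne_zero hzt
    refine (((hasDerivAt_chartHerm hg hU hzt hΓ u u).pow 3).div
      ((hasDerivAt_chartDet hg hU hzt hΓ).pow 2) (pow_ne_zero 2 hδ)).congr_deriv ?_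
    rw [div_eq_zero_iff]
    left
    simp only [Pi.pow_apply]
    push_cast
    ring
  have h := constant_of_has_deriv_right_zero
    (fun t ht => (hder t ht).continuousAt.continuousWithinAt)
    (fun t ht => (hder t ⟨ht.1, ht.2.le⟩).hasDerivWithinAt) 1 ⟨zero_le_one, le_rfl⟩
  simpa [hu] using h

end Lines

end Weight

section LocalForm

/-! ### Compatible metrics locally come from hermitian forms -/

theorem exists_cube_eq (x : ℝ) : ∃ r : ℝ, r ^ 3 = x := by
  rcases le_total 0 x with hx | hx
  · exact ⟨x ^ ((3 : ℕ) : ℝ)⁻¹, Real.rpow_inv_natCast_pow hx (by norm_num)⟩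
  · refine ⟨-(-x) ^ ((3 : ℕ) : ℝ)⁻¹, ?_⟩
    rw [Odd.neg_pow (by decide), Real.rpow_inv_natCast_pow (by linarith) (by norm_num), neg_neg]

/-- The covector of the line through `ζ` in the direction `w`, in the coordinates of the first affine
chart. -/
def lineVec (ζ w : C2) : C3 := ![ζ 0 * w 1 - ζ 1 * w 0, -w 1, w 0]

/-- Passing to the first chart centred at `z₀` is a linear change of homogeneous coordinates, and
`S` is its induced action on cross products. This moves a neighbourhood of `z₀` to a polydisc around
`0`. -/
theorem exists_lineVec_eq (k : Fin 3) (z₀ : C2) : ∃ S : Matrix (Fin 3) (Fin 3) ℂ,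
    IsUnit S.det ∧ ∀ z w, lineVec (z - z₀) w = S *ᵥ crossVec k z w := by
  fin_cases k
  · refine ⟨!![1, z₀ 0, z₀ 1; 0, 1, 0; 0, 0, 1], by simp [Matrix.det_fin_three], fun z w => ?_⟩
    have h1 : homog 0 z = ![1, z 0, z 1] := by ext j; fin_cases j <;> rfl
    have h2 : direction 0 w = ![0, w 0, w 1] := by ext j; fin_cases j <;> rfl
    change _ = _ *ᵥ crossVec 0 z w
    rw [crossVec, h1, h2]
    ext j
    fin_cases j <;> simp [lineVec, cross_apply, Matrix.mulVec, dotProduct, Fin.sum_univ_three]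
    ring
  · refine ⟨!![-z₀ 0, -1, -z₀ 1; -1, 0, 0; 0, 0, -1], by simp [Matrix.det_fin_three],
      fun z w => ?_⟩
    ext j
    fin_cases j <;> simp [lineVec, crossVec, cross_apply, homog, direction, Fin.insertNth,
      Fin.succAboveCases, Matrix.mulVec, dotProduct, Fin.sum_univ_three]
    ring
  · refine ⟨!![z₀ 0, z₀ 1, 1; 1, 0, 0; 0, 1, 0], by simp [Matrix.det_fin_three], fun z w => ?_⟩
    ext j
    fin_cases j <;> simp [lineVec, crossVec, cross_apply, homog, direction, Fin.insertNth,
      Fin.succAboveCases, Matrix.mulVec, dotProduct, Fin.sum_univ_three]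
    ring

/-- The pullback of a sesquilinear form by a matrix. -/
def pullback (S C : Matrix (Fin 3) (Fin 3) ℂ) : Matrix (Fin 3) (Fin 3) ℂ := Sᵀ * C * S.map star

theorem hform_mulVec (S C : Matrix (Fin 3) (Fin 3) ℂ) (ξ η : C3) :
    hform C (S *ᵥ ξ) (S *ᵥ η) = hform (pullback S C) ξ η := by
  have h : star (S *ᵥ η) = S.map star *ᵥ star η := by
    ext i
    simp [Matrix.mulVec, dotProduct]
  rw [hform, hform, pullback, h, ← Matrix.mulVec_mulVec, ← Matrix.mulVec_mulVec,
    Matrix.dotProduct_mulVec ξ, Matrix.vecMul_transpose]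

theorem isHermitian_pullback {S C : Matrix (Fin 3) (Fin 3) ℂ} (hC : C.IsHermitian) :
    (pullback S C).IsHermitian := by
  have h1 : (S.map star)ᴴ = Sᵀ := by ext i j; simp
  have h2 : (Sᵀ)ᴴ = S.map star := by ext i j; simp
  rw [Matrix.IsHermitian, pullback, Matrix.conjTranspose_mul, Matrix.conjTranspose_mul, hC.eq, h1,
    h2, Matrix.mul_assoc]

section Local

variable {g : BilinField} {U : Set CP2} {k : Fin 3} {z₀ : C2}

theorem IsPseudoKahler.inChart_self_eq (hg : IsPseudoKahler g U) {z : C2}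
    (hz : z ∈ coordDomain U k) (q : ℝ) (u : C2) :
    hermForm (q * g.inChart k z e₁ e₁) (q * g.inChart k z e₂ e₂) (q * chartHerm g k z e₁ e₂)
      (u 0) (u 1) = q * g.inChart k z u u := by
  have h : (g.inChart k z u u : ℝ) = (chartHerm g k z u u).re := rfl
  have h1 : (chartHerm g k z e₁ e₁) = g.inChart k z e₁ e₁ := (hg.ofReal_inChart_self hz _).symm
  have h2 : (chartHerm g k z e₂ e₂) = g.inChart k z e₂ e₂ := (hg.ofReal_inChart_self hz _).symm
  have h3 : chartHerm g k z e₂ e₁ = star (chartHerm g k z e₁ e₂) :=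
    (hg.star_chartHerm hz _ _).symm
  have h4 : chartHerm g k z u u = u 0 * star (u 0) * chartHerm g k z e₁ e₁
      + u 1 * star (u 1) * chartHerm g k z e₂ e₂ + u 0 * star (u 1) * chartHerm g k z e₁ e₂
      + u 1 * star (u 0) * chartHerm g k z e₂ e₁ := by
    refine (congrArg (fun v => chartHerm g k z v v) (eq_smul_e u)).trans ?_
    simp only [chartHerm_add_left, chartHerm_add_right, hg.chartHerm_smul_left hz,
      hg.chartHerm_smul_right hz]
    ring
  rw [h, h4, h1, h2, h3]
  simp only [hermForm, Complex.normSq_apply, Complex.mul_re, Complex.mul_im, Complex.star_def,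
    Complex.conj_re, Complex.conj_im, Complex.add_re, Complex.ofReal_re, Complex.ofReal_im]
  ring

/-- The polynomial fields of `ConstOnLines.eq_polynomial` are exactly the restrictions of constant
hermitian forms to the covectors of lines. The parameters are the entries of the matrix. -/
theorem hform_lineVec (a a' c : ℝ) (b b' n : ℂ) (ζ u : C2) :
    (-hform !![-(c : ℂ), b', b; star b', -(a' : ℂ), star n; star b, n, -(a : ℂ)]
      (lineVec ζ u) (lineVec ζ u)).re
      = hermForm (a + 2 * (b * ζ 1).re + c * Complex.normSq (ζ 1))
        (a' + 2 * (b' * ζ 0).re + c * Complex.normSq (ζ 0))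
        (n - star b * star (ζ 0) - b' * ζ 1 - c * ζ 1 * star (ζ 0)) (u 0) (u 1) := by
  simp [hform, lineVec, dotProduct, Matrix.mulVec, Fin.sum_univ_three, hermForm,
    Complex.normSq_apply]
  ring

theorem exists_hform_eq (hg : IsPseudoKahler g U) (hU : IsOpen U)
    (hp : IsPlanar (leviCivita g) U) (hz₀ : z₀ ∈ coordDomain U k) :
    ∃ C : Matrix (Fin 3) (Fin 3) ℂ, C.IsHermitian ∧ ∀ᶠ z in nhds z₀, z ∈ coordDomain U k ∧
      ∃ r : ℝ, r ^ 3 * (chartDet g k z).re = 1 ∧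
        ∀ u, r ^ 2 * g.inChart k z u u = (-hform C (crossVec k z u) (crossVec k z u)).re := by
  obtain ⟨ε, hε, hball⟩ := Metric.isOpen_iff.1 (isOpen_coordDomain hU k) z₀ hz₀
  -- The weight `r² = det^(-2/3)` turns constancy of `g(u, u)³ / det²` into constancy of `r² g(u,
  -- u)`. The real cube root exists for either sign of the determinant.
  choose r hr using fun z => exists_cube_eq (chartDet g k z).re⁻¹
  have hdet : ∀ z ∈ coordDomain U k, (chartDet g k z).re ≠ 0 := by
    intro z hz h
    apply hg.chartDet_ne_zero hz
    rw [← hg.ofReal_re_chartDet hz, h, Complex.ofReal_zero]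
  let sh : ℂ → ℂ → C2 := fun z₁ z₂ => z₀ + ![z₁, z₂]
  have hsh : ∀ z₁ z₂ : ℂ, ‖z₁‖ < ε → ‖z₂‖ < ε → sh z₁ z₂ ∈ Metric.ball z₀ ε := by
    intro z₁ z₂ h₁ h₂
    rw [mem_ball_iff_norm, add_sub_cancel_left, pi_norm_lt_iff hε]
    intro i
    fin_cases i
    · exact h₁
    · exact h₂
  have hQ : ∀ z ∈ Metric.ball z₀ ε, ∀ y ∈ Metric.ball z₀ ε,
      r z ^ 2 * g.inChart k z (y - z) (y - z) = r y ^ 2 * g.inChart k y (y - z) (y - z) := by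
    intro z hz y hy
    have h := inChart_cube_eq hg hU hp (convex_ball z₀ ε) hball hz hy
    rw [← hg.ofReal_inChart_self (hball hz), ← hg.ofReal_inChart_self (hball hy),
      ← hg.ofReal_re_chartDet (hball hz), ← hg.ofReal_re_chartDet (hball hy)] at h
    norm_cast at h
    have hcube : ∀ x (t : ℝ), (r x ^ 2 * t) ^ 3 = t ^ 3 / (chartDet g k x).re ^ 2 := by
      intro x t
      have : (r x ^ 2 * t) ^ 3 = (r x ^ 3) ^ 2 * t ^ 3 := by ring
      rw [this, hr]
      ring
    apply (Odd.strictMono_pow (by decide : Odd 3)).injective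
    change (_ : ℝ) ^ 3 = (_ : ℝ) ^ 3
    rw [hcube, hcube]
    exact h.symm
  have hconst : ConstOnLines ε (fun z₁ z₂ => r (sh z₁ z₂) ^ 2 * g.inChart k (sh z₁ z₂) e₁ e₁)
      (fun z₁ z₂ => r (sh z₁ z₂) ^ 2 * g.inChart k (sh z₁ z₂) e₂ e₂)
      (fun z₁ z₂ => ((r (sh z₁ z₂) ^ 2 : ℝ) : ℂ) * chartHerm g k (sh z₁ z₂) e₁ e₂) := by
    intro z₁ z₂ y₁ y₂ hz₁ hz₂ hy₁ hy₂
    have hz := hsh z₁ z₂ hz₁ hz₂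
    have hy := hsh y₁ y₂ hy₁ hy₂
    have hd : sh y₁ y₂ - sh z₁ z₂ = ![y₁ - z₁, y₂ - z₂] := by
      simp [sh]
    have e1 := hg.inChart_self_eq (hball hz) (r (sh z₁ z₂) ^ 2) ![y₁ - z₁, y₂ - z₂]
    have e2 := hg.inChart_self_eq (hball hy) (r (sh y₁ y₂) ^ 2) ![y₁ - z₁, y₂ - z₂]
    have e3 := hQ _ hz _ hy
    rw [hd] at e3
    rw [← e1, ← e2] at e3
    exact e3
  obtain ⟨a, a', c, b, b', n, hpoly⟩ := hconst.eq_polynomial hε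
  obtain ⟨S, -, hS⟩ := exists_lineVec_eq k z₀
  set C' : Matrix (Fin 3) (Fin 3) ℂ :=
    !![-(c : ℂ), b', b; star b', -(a' : ℂ), star n; star b, n, -(a : ℂ)] with hC'
  have hC'h : C'.IsHermitian := by
    ext i j
    fin_cases i <;> fin_cases j <;> simp [hC']
  refine ⟨pullback S C', isHermitian_pullback hC'h, ?_⟩
  filter_upwards [Metric.ball_mem_nhds z₀ (half_pos hε)] with z hz
  have hzε : z ∈ Metric.ball z₀ ε := Metric.ball_subset_ball (by linarith) hz
  have hzn : ‖z - z₀‖ < ε / 2 := mem_ball_iff_norm.1 hz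
  have hshz : sh ((z - z₀) 0) ((z - z₀) 1) = z := by
    ext i
    fin_cases i
    · exact add_sub_cancel (z₀ 0) (z 0)
    · exact add_sub_cancel (z₀ 1) (z 1)
  refine ⟨hball hzε, r z, ?_, fun u => ?_⟩
  · rw [hr, inv_mul_cancel₀ (hdet z (hball hzε))]
  · obtain ⟨h1, h2, h3⟩ := hpoly ((z - z₀) 0) ((z - z₀) 1)
      ((norm_le_pi_norm (z - z₀) 0).trans_lt hzn) ((norm_le_pi_norm (z - z₀) 1).trans_lt hzn)
    rw [hshz] at h1 h2 h3
    rw [← hform_mulVec, ← hS, hform_lineVec, ← hg.inChart_self_eq (hball hzε), h1, h2, h3]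

theorem exists_metricOf_eq (hg : IsPseudoKahler g U) (hU : IsOpen U)
    (hp : IsPlanar (leviCivita g) U) (hz₀ : z₀ ∈ coordDomain U k) :
    ∃ C : Matrix (Fin 3) (Fin 3) ℂ, C.IsHermitian ∧ ∀ᶠ z in nhds z₀,
      discr C (homog k z) ≠ 0 ∧ ∀ u w, g.inChart k z u w = (metricOf C).inChart k z u w := by
  obtain ⟨C, hC, h⟩ := exists_hform_eq hg hU hp hz₀
  refine ⟨C, hC, h.mono fun z ⟨hz, r, hr, hru⟩ => ?_⟩
  have hr0 : r ≠ 0 := by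
    rintro rfl
    simp at hr
  -- Equality of quadratic forms is polarised to the real bilinear forms, and then with `i w` to the
  -- hermitian forms.
  have hpol : ∀ u w, r ^ 2 * g.inChart k z u w
      = (-hform C (crossVec k z u) (crossVec k z w)).re := by
    intro u w
    have h1 := hru (u + w)
    rw [crossVec_add, hform_add_left, hform_add_right, hform_add_right, inChart_add_left,
      inChart_add_right, inChart_add_right, hg.inChart_symm hz w u,
      ← star_hform hC (crossVec k z u) (crossVec k z w)] at h1
    have h2 := hru u
    have h3 := hru w
    simp at h1 h2 h3 ⊢
    linarith
  have hcplx : ∀ u w, (r : ℂ) ^ 2 * chartHerm g k z u w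
      = -hform C (crossVec k z u) (crossVec k z w) := by
    intro u w
    rw [← Complex.ofReal_pow]
    apply Complex.ext
    · rw [Complex.re_ofReal_mul]
      exact hpol u w
    · rw [Complex.im_ofReal_mul]
      refine (hpol u (Complex.I • w)).trans ?_
      rw [crossVec_smul, hform_smul_right]
      simp
  -- Taking determinants in `r² h = -hform` gives `r⁴ det h = discr C`, while `r³ det h = 1`.
  have hdisc : discr C (homog k z) = r := by
    have h1 := hform_crossVec_det hC k z
    have h2 : (r : ℂ) ^ 4 * chartDet g k z = discr C (homog k z) := by
      rw [← h1, chartDet]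
      have e1 := hcplx e₁ e₁
      have e2 := hcplx e₂ e₂
      have e3 := hcplx e₁ e₂
      have e4 := hcplx e₂ e₁
      rw [eq_neg_iff_add_eq_zero, add_comm, ← eq_neg_iff_add_eq_zero] at e1 e2 e3 e4
      rw [e1, e2, e3, e4]
      ring
    rw [← hg.ofReal_re_chartDet hz] at h2
    norm_cast at h2
    rw [← h2]
    linear_combination r * hr
  refine ⟨hdisc ▸ hr0, fun u w => ?_⟩
  rw [inChart_metricOf, hdisc, ← hcplx]
  have hrc : (r : ℂ) ≠ 0 := Complex.ofReal_ne_zero.2 hr0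
  rw [mul_div_cancel_left₀ _ (pow_ne_zero 2 hrc)]
  rfl

end Local

end LocalForm

section Uniqueness

variable {C C' : Matrix (Fin 3) (Fin 3) ℂ}

/-! ### The hermitian form is determined by its metric -/

theorem pullback_pullback (S T C : Matrix (Fin 3) (Fin 3) ℂ) :
    pullback S (pullback T C) = pullback (T * S) C := by
  have h : (T * S).map star = T.map star * S.map star := Matrix.map_mul (f := starRingEnd ℂ)
  simp only [pullback, Matrix.transpose_mul, h, Matrix.mul_assoc]

theorem pullback_one (C : Matrix (Fin 3) (Fin 3) ℂ) : pullback 1 C = C := by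
  simp [pullback]

theorem hermForm_eq_zero {A D : ℝ} {B : ℂ} (h : ∀ u : C2, hermForm A D B (u 0) (u 1) = 0) :
    A = 0 ∧ D = 0 ∧ B = 0 := by
  have h1 := h ![1, 0]
  have h2 := h ![0, 1]
  have h3 := h ![1, 1]
  have h4 := h ![1, Complex.I]
  simp [hermForm] at h1 h2 h3 h4
  subst h1 h2
  refine ⟨rfl, rfl, Complex.ext ?_ ?_⟩
  · simpa using h3
  · simpa using h4

/-- By `hform_lineVec` the entries of `C` are, up to sign and conjugation, coefficients of
polynomials that vanish near `0`. -/
theorem eq_zero_of_hform_lineVec (hC : C.IsHermitian) {ε : ℝ} (hε : 0 < ε)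
    (h : ∀ ζ : C2, ‖ζ‖ < ε → ∀ u, (hform C (lineVec ζ u) (lineVec ζ u)).re = 0) : C = 0 := by
  have hij : ∀ i j, star (C i j) = C j i := fun i j => hC.apply j i
  have hdiag : ∀ i, C i i = ((C i i).re : ℂ) := fun i => (Complex.conj_eq_iff_re.1 (hij i i)).symm
  set a : ℝ := -(C 2 2).re
  set a' : ℝ := -(C 1 1).re
  set c : ℝ := -(C 0 0).re
  have hCe : C = !![-(c : ℂ), C 0 1, C 0 2; star (C 0 1), -(a' : ℂ), star (C 2 1);
      star (C 0 2), C 2 1, -(a : ℂ)] := by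
    ext i j
    fin_cases i <;> fin_cases j <;>
      simp [a, a', c, hij] <;> exact hdiag _
  have key : ∀ z₁ z₂ : ℂ, ‖z₁‖ < ε → ‖z₂‖ < ε →
      a + 2 * (C 0 2 * z₂).re + c * Complex.normSq z₂ = 0 ∧
      a' + 2 * (C 0 1 * z₁).re + c * Complex.normSq z₁ = 0 ∧
      C 2 1 - star (C 0 2) * star z₁ - C 0 1 * z₂ - c * z₂ * star z₁ = 0 := by
    intro z₁ z₂ h₁ h₂
    refine hermForm_eq_zero fun u => ?_
    have hn : ‖(![z₁, z₂] : C2)‖ < ε := by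
      rw [pi_norm_lt_iff hε]
      intro i
      fin_cases i
      · exact h₁
      · exact h₂
    have h1 := hform_lineVec a a' c (C 0 2) (C 0 1) (C 2 1) ![z₁, z₂] u
    rw [← hCe, Complex.neg_re, h _ hn u, neg_zero] at h1
    exact h1.symm
  obtain ⟨ha, -, hb, -, hc, -⟩ := coeff_eq_zero hε (α := a) (β := 0) (β' := C 0 2) (γ := 0)
    (γ' := c) (κ := 0) fun z₁ z₂ h₁ h₂ => by simpa using (key z₁ z₂ h₁ h₂).1
  obtain ⟨ha', hb', -⟩ := coeff_eq_zero hε (α := a') (β := C 0 1) (β' := 0) (γ := c)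
    (γ' := 0) (κ := 0) fun z₁ z₂ h₁ h₂ => by simpa using (key z₁ z₂ h₁ h₂).2.1
  have hn : C 2 1 = 0 := by
    simpa using (key 0 0 (by simpa using hε) (by simpa using hε)).2.2
  rw [hCe, ha, ha', hb, hb', hc, hn]
  ext i j
  fin_cases i <;> fin_cases j <;> simp

theorem hform_sub (C C' : Matrix (Fin 3) (Fin 3) ℂ) (ξ η : C3) :
    hform (C - C') ξ η = hform C ξ η - hform C' ξ η := by
  simp [hform, Matrix.sub_mulVec]

theorem chartHerm_metricOf (k : Fin 3) (z u w : C2) :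
    chartHerm (metricOf C) k z u w
      = -(hform C (crossVec k z u) (crossVec k z w)) / (discr C (homog k z) : ℂ) ^ 2 :=
  Complex.ext (inChart_metricOf C k z u w) (inChart_metricOf_I k z u w)

theorem chartDet_metricOf (hC : C.IsHermitian) {k : Fin 3} {z : C2}
    (hz : discr C (homog k z) ≠ 0) :
    (discr C (homog k z) : ℂ) ^ 3 * chartDet (metricOf C) k z = 1 := by
  have hDc : (discr C (homog k z) : ℂ) ≠ 0 := Complex.ofReal_ne_zero.2 hz
  have h := hform_crossVec_det hC k z
  simp only [chartDet, chartHerm_metricOf]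
  field_simp
  linear_combination h

/-- The determinant of the metric is `discr⁻³` and real cubes are injective, so the denominators
agree. Then the numerators agree on all covectors of lines near `z₀`, which determines the matrix.
-/
theorem eq_of_inChart_metricOf_eq (hC : C.IsHermitian) (hC' : C'.IsHermitian) {k : Fin 3} {z₀ : C2}
    (h : ∀ᶠ z in nhds z₀, discr C (homog k z) ≠ 0 ∧ discr C' (homog k z) ≠ 0 ∧
      ∀ u w, (metricOf C).inChart k z u w = (metricOf C').inChart k z u w) : C = C' := by
  obtain ⟨ε, hε, hball⟩ := Metric.eventually_nhds_iff_ball.1 h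
  obtain ⟨S, hSu, hS⟩ := exists_lineVec_eq k z₀
  have hD : (C - C').IsHermitian := hC.sub hC'
  have hz : pullback S⁻¹ (C - C') = 0 := by
    refine eq_zero_of_hform_lineVec (isHermitian_pullback hD) hε fun ζ hζ u => ?_
    obtain ⟨h1, h2, h3⟩ := hball (z₀ + ζ) (by simpa using hζ)
    have hl : lineVec ζ u = S *ᵥ crossVec k (z₀ + ζ) u := by
      rw [← hS, add_sub_cancel_left]
    rw [← hform_mulVec, hl, Matrix.mulVec_mulVec, Matrix.nonsing_inv_mul S hSu, Matrix.one_mulVec,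
      hform_sub]
    have hH : chartHerm (metricOf C) k (z₀ + ζ) = chartHerm (metricOf C') k (z₀ + ζ) := by
      ext1 u
      ext1 w
      exact Complex.ext (h3 u w) (h3 u (Complex.I • w))
    have hdet : chartDet (metricOf C) k (z₀ + ζ) = chartDet (metricOf C') k (z₀ + ζ) := by
      simp only [chartDet, hH]
    have e1 := chartDet_metricOf hC h1
    have e2 := chartDet_metricOf hC' h2
    rw [hdet] at e1
    have hne : chartDet (metricOf C') k (z₀ + ζ) ≠ 0 := right_ne_zero_of_mul (e2 ▸ one_ne_zero)
    have hcube : discr C (homog k (z₀ + ζ)) ^ 3 = discr C' (homog k (z₀ + ζ)) ^ 3 := by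
      exact_mod_cast mul_right_cancel₀ hne (e1.trans e2.symm)
    have hdisc := (Odd.strictMono_pow (by decide : Odd 3)).injective hcube
    have hu := congrFun (congrFun hH u) u
    rw [chartHerm_metricOf, chartHerm_metricOf, hdisc] at hu
    have hDc : (discr C' (homog k (z₀ + ζ)) : ℂ) ^ 2 ≠ 0 :=
      pow_ne_zero 2 (Complex.ofReal_ne_zero.2 h2)
    rw [div_left_inj' hDc, neg_inj] at hu
    rw [hu, sub_self, Complex.zero_re]
  have := congrArg (pullback S) hz
  rw [pullback_pullback, Matrix.nonsing_inv_mul S hSu, pullback_one] at this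
  rw [← sub_eq_zero, this]
  simp [pullback]

/-! ### Rank and adjugate -/

theorem hform_single (i j : Fin 3) : hform C (Pi.single i 1) (Pi.single j 1) = C i j := by
  have : star (Pi.single j 1 : C3) = Pi.single j 1 := by
    rw [← Pi.single_star, star_one]
  rw [hform, this]
  simp

/-- If the adjugate vanishes, so do all 2×2 minors, and the matrix is the product of one of its
columns with a scaled row. -/
theorem adjugate_ne_zero_of_two_le_rank (h : 2 ≤ C.rank) : C.adjugate ≠ 0 := by
  intro h0
  have hminor : ∀ a b i j, C a b * C i j = C a j * C i b := by
    intro a b i j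
    have := hform_det C (Pi.single a 1) (Pi.single i 1) (Pi.single b 1) (Pi.single j 1)
    rw [h0, Matrix.zero_mulVec, dotProduct_zero] at this
    simp only [hform_single] at this
    exact sub_eq_zero.1 this
  have hC : C ≠ 0 := by
    rintro rfl
    simp at h
  obtain ⟨i, j, hij⟩ : ∃ i j, C i j ≠ 0 := by
    by_contra! h
    exact hC (Matrix.ext h)
  have hvec : C = Matrix.vecMulVec (fun a => C a j) (fun b => C i b / C i j) := by
    ext a b
    rw [Matrix.vecMulVec_apply, mul_div_assoc', eq_div_iff hij]
    exact hminor a b i j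
  have := Matrix.rank_vecMulVec_le (fun a => C a j) (fun b => C i b / C i j)
  rw [← hvec] at this
  omega

theorem two_le_rank_of_adjugate_ne_zero (h : C.adjugate ≠ 0) : 2 ≤ C.rank := by
  obtain ⟨i, j, hij⟩ : ∃ i j, C.adjugate i j ≠ 0 := by
    by_contra! h'
    exact h (Matrix.ext h')
  rw [Matrix.adjugate_fin_succ_eq_det_submatrix] at hij
  have hdet := right_ne_zero_of_mul hij
  have h2 := Matrix.rank_of_det_ne_zero hdet
  have h3 : (C.submatrix j.succAbove i.succAbove).rank ≤ C.rank :=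
    Matrix.rank_submatrix_le _ _ _
  simpa [h2] using h3

theorem two_le_rank_of_discr_ne_zero {v : C3} (h : discr C v ≠ 0) : 2 ≤ C.rank := by
  refine two_le_rank_of_adjugate_ne_zero fun h0 => h ?_
  simp [discr, h0]

/-! ### The regular set -/

theorem eq_zero_of_re_form_eq_zero {A : Matrix (Fin 3) (Fin 3) ℂ} (hA : A.IsHermitian)
    (h : ∀ v : C3, (star v ⬝ᵥ (A *ᵥ v)).re = 0) : A = 0 := by
  have hij : ∀ i j, star (A i j) = A j i := fun i j => hA.apply j i
  have hs : ∀ (i : Fin 3) (c : ℂ), star (Pi.single i c : C3) = Pi.single i (star c) :=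
    fun i c => by
      ext j
      by_cases hj : j = i <;> simp [hj]
  have hd : ∀ i, (A i i).re = 0 := fun i => by
    simpa [hs] using h (Pi.single i 1)
  ext i j
  have h1 := h (Pi.single i 1 + Pi.single j 1)
  have h2 := h (Pi.single i 1 + Pi.single j Complex.I)
  simp [hs, Matrix.mulVec_add, add_dotProduct, dotProduct_add, hd, ← hij i j] at h1 h2
  apply Complex.ext
  · simp; linarith
  · simp; linarith

/-- The second difference of the quadratic form `discr C` along any direction `w` is a positive
multiple of `discr C w`. Vanishing near one point would thus force `adj(C) = 0`. -/
theorem exists_discr_ne_zero (hC : C.IsHermitian) (hr : 2 ≤ C.rank) {s : Set C3} {v₀ : C3}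
    (hs : s ∈ nhds v₀) : ∃ v ∈ s, discr C v ≠ 0 := by
  by_contra! h
  refine adjugate_ne_zero_of_two_le_rank hr (eq_zero_of_re_form_eq_zero hC.adjugate fun w => ?_)
  have hcont : Continuous fun t : ℝ => v₀ + (t : ℂ) • w := by fun_prop
  have hev : ∀ᶠ t : ℝ in nhds 0, v₀ + (t : ℂ) • w ∈ s :=
    hcont.continuousAt.eventually_mem (by simpa using hs)
  obtain ⟨ε, hε, hball⟩ := Metric.eventually_nhds_iff_ball.1 hev
  have hε' : |ε / 2| < ε := by rw [abs_of_pos (half_pos hε)]; linarith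
  have h1 := h _ (hball (ε / 2) (by rwa [mem_ball_zero_iff, Real.norm_eq_abs]))
  have h2 := h _ (hball (-(ε / 2)) (by rwa [mem_ball_zero_iff, Real.norm_eq_abs, abs_neg]))
  have h0 := h v₀ (mem_of_mem_nhds hs)
  rw [discr_add_smul hC, h0] at h1 h2
  have h3 : (ε / 2) ^ 2 * discr C w = 0 := by linarith
  exact (mul_eq_zero.1 h3).resolve_left (by positivity)

end Uniqueness

/-! ### Openness of the regular set and gluing of local forms -/

section Global

variable {C C' : Matrix (Fin 3) (Fin 3) ℂ}

theorem mk_mem_regularSet_iff (v : C3) (hv : v ≠ 0) :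
    Projectivization.mk ℂ v hv ∈ regularSet C ↔ discr C v ≠ 0 := by
  have hl : v (index (Projectivization.mk ℂ v hv)) ≠ 0 :=
    (mk_mem_source_iff _ _ hv).1 (mem_source_index _)
  rw [regularSet, Set.mem_ofPred_eq, point, homog_affineChart_mk _ _ _ hl, discr_smul]
  simp [hl]

theorem isOpen_regularSet (C : Matrix (Fin 3) (Fin 3) ℂ) : IsOpen (regularSet C) := by
  rw [← isQuotientMap_mk.isOpen_preimage]
  have h : (Projectivization.mk' ℂ : {v : C3 // v ≠ 0} → CP2) ⁻¹' regularSet C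
      = {v | discr C v.1 ≠ 0} := by
    ext v
    exact mk_mem_regularSet_iff v.1 v.2
  have hcont : Continuous fun v : C3 => discr C v := by
    unfold discr
    fun_prop
  rw [h]
  exact isOpen_ne.preimage (hcont.comp continuous_subtype_val)

theorem exists_mem_regularSet (hC : C.IsHermitian) (hr : 2 ≤ C.rank) {U : Set CP2} (hU : IsOpen U)
    (hne : U.Nonempty) : (U ∩ regularSet C).Nonempty := by
  obtain ⟨p, hp⟩ := hne
  have hopen : IsOpen (Subtype.val '' ((Projectivization.mk' ℂ : {v : C3 // v ≠ 0} → CP2) ⁻¹' U)) :=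
    (isOpen_ne (x := (0 : C3))).isOpenMap_subtype_val _ (hU.preimage isQuotientMap_mk.continuous)
  have hmem : p.rep ∈ Subtype.val '' ((Projectivization.mk' ℂ : {v : C3 // v ≠ 0} → CP2) ⁻¹' U) := by
    refine ⟨⟨p.rep, p.rep_nonzero⟩, ?_, rfl⟩
    change Projectivization.mk ℂ p.rep p.rep_nonzero ∈ U
    rwa [p.mk_rep]
  obtain ⟨_, ⟨v, hv, rfl⟩, hd⟩ := exists_discr_ne_zero hC hr (hopen.mem_nhds hmem)
  exact ⟨Projectivization.mk ℂ v.1 v.2, hv, (mk_mem_regularSet_iff v.1 v.2).2 hd⟩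

/-- Part of a chart ball suffices: the set in question, `U ∩ D_C` in the application, need not be
connected itself. -/
theorem exists_isConnected_subset {U : Set CP2} (hU : IsOpen U) (hne : U.Nonempty) :
    ∃ V ⊆ U, IsOpen V ∧ IsConnected V := by
  obtain ⟨p, hp⟩ := hne
  obtain ⟨k, z, rfl⟩ := exists_eq_affineChart_symm p
  obtain ⟨ε, hε, hball⟩ := Metric.isOpen_iff.1 (isOpen_coordDomain hU k) z hp
  refine ⟨(affineChart k).symm '' Metric.ball z ε, Set.image_subset_iff.2 hball, ?_, ?_⟩
  · exact (affineChart k).symm.isOpen_image_of_subset_source Metric.isOpen_ball (Set.subset_univ _)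
  · exact ((convex_ball z ε).isConnected ⟨z, Metric.mem_ball_self hε⟩).image _
      (continuous_affineChart_symm k).continuousOn

/-- `C` is a hermitian form with the metric `g` near `p`. -/
def IsLocalForm (g : BilinField) (p : CP2) (C : Matrix (Fin 3) (Fin 3) ℂ) : Prop :=
  C.IsHermitian ∧ ∀ᶠ q in nhds p, q ∈ regularSet C ∧ g q = metricOf C q

theorem IsLocalForm.unique {g : BilinField} {p : CP2} (h : IsLocalForm g p C)
    (h' : IsLocalForm g p C') : C = C' := by
  obtain ⟨k, z, rfl⟩ := exists_eq_affineChart_symm p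
  refine eq_of_inChart_metricOf_eq h.1 h'.1 (k := k) (z₀ := z) ?_
  have hc := (continuous_affineChart_symm k).continuousAt (x := z)
  filter_upwards [hc.eventually h.2, hc.eventually h'.2] with x hx hx'
  refine ⟨(symm_mem_regularSet_iff k x).1 hx.1, (symm_mem_regularSet_iff k x).1 hx'.1,
    fun u w => ?_⟩
  rw [inChart_eq, inChart_eq, ← hx.2, ← hx'.2]

theorem exists_isLocalForm {g : BilinField} {U : Set CP2} (hU : IsOpen U)
    (hg : IsCompatibleMetric g U) {p : CP2} (hp : p ∈ U) : ∃ C, IsLocalForm g p C := by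
  have hsrc := mem_source_index p
  have hz₀ : affineChart (index p) p ∈ coordDomain U (index p) := by
    change (affineChart (index p)).symm (affineChart (index p) p) ∈ U
    rwa [affineChart_symm_affineChart hsrc]
  obtain ⟨C, hC, h⟩ := exists_metricOf_eq hg.1 hU (isPlanar_of_equivalent hU hg.2) hz₀
  refine ⟨C, hC, ?_⟩
  filter_upwards [((affineChart (index p)).continuousAt hsrc).eventually h,
    (affineChart (index p)).open_source.mem_nhds hsrc] with q hq hqs
  have h1 := (symm_mem_regularSet_iff (C := C) _ _).2 hq.1
  have h2 := eq_of_inChart_eq hq.2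
  rw [affineChart_symm_affineChart hqs] at h1 h2
  exact ⟨h1, h2⟩

theorem exists_global_form {g : BilinField} {U : Set CP2} (hU : IsOpen U) (hUc : IsConnected U)
    (hg : IsCompatibleMetric g U) :
    ∃ C : Matrix (Fin 3) (Fin 3) ℂ, ∀ p ∈ U, IsLocalForm g p C := by
  choose F hF using fun p : U => exists_isLocalForm hU hg p.2
  have hloc : IsLocallyConstant F := by
    refine (IsLocallyConstant.iff_eventually_eq F).2 fun p => ?_
    -- The form chosen at `p` also represents `g` near every nearby `q`, so uniqueness identifies it
    -- with the form chosen at `q`.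
    have h := continuous_subtype_val.continuousAt.eventually (hF p).2.eventually_nhds
    filter_upwards [h] with q hq
    exact (hF q).unique ⟨(hF p).1, hq⟩
  have : PreconnectedSpace U := Subtype.preconnectedSpace hUc.isPreconnected
  obtain ⟨p₀, hp₀⟩ := hUc.nonempty
  refine ⟨F ⟨p₀, hp₀⟩, fun p hp => ?_⟩
  rw [hloc.apply_eq_of_preconnectedSpace ⟨p₀, hp₀⟩ ⟨p, hp⟩]
  exact hF ⟨p, hp⟩

end Global

end CProj

end

theorem mainTheorem1 (U : Set CProj.CP2) (hU : IsOpen U) (hUc : IsConnected U) :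
    (∀ C : Matrix (Fin 3) (Fin 3) ℂ, C.IsHermitian → 2 ≤ C.rank → U ⊆ CProj.regularSet C →
      CProj.IsCompatibleMetric (CProj.metricOf C) U) ∧
    (∀ g : CProj.BilinField, CProj.IsCompatibleMetric g U →
      ∃! C : Matrix (Fin 3) (Fin 3) ℂ, C.IsHermitian ∧ 2 ≤ C.rank ∧ U ⊆ CProj.regularSet C ∧
        ∀ p ∈ U, g p = CProj.metricOf C p) ∧
    (∀ C : Matrix (Fin 3) (Fin 3) ℂ, C.IsHermitian → 2 ≤ C.rank →
      ∃ V : Set CProj.CP2, V ⊆ U ∧ V ⊆ CProj.regularSet C ∧ IsOpen V ∧ IsConnected V) := by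
  obtain ⟨p₀, hp₀⟩ := hUc.nonempty
  refine ⟨fun C hC _ hUC => CProj.isCompatibleMetric_metricOf hC hUC, fun g hg => ?_,
    fun C hC hr => ?_⟩
  · obtain ⟨C, h⟩ := CProj.exists_global_form hU hUc hg
    refine ⟨C, ⟨(h p₀ hp₀).1, CProj.two_le_rank_of_discr_ne_zero (h p₀ hp₀).2.self_of_nhds.1,
      fun p hp => (h p hp).2.self_of_nhds.1, fun p hp => (h p hp).2.self_of_nhds.2⟩, ?_⟩
    rintro C' ⟨hC', -, hreg, heq⟩
    -- Uniqueness needs only the germ of `g` at a single point of `U`.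
    refine CProj.IsLocalForm.unique (g := g) (p := p₀) ⟨hC', ?_⟩ (h p₀ hp₀)
    filter_upwards [hU.mem_nhds hp₀] with q hq
    exact ⟨hreg hq, heq q hq⟩
  · obtain ⟨V, hV, hVo, hVc⟩ := CProj.exists_isConnected_subset
      (hU.inter (CProj.isOpen_regularSet C)) (CProj.exists_mem_regularSet hC hr hU hUc.nonempty)
    exact ⟨V, fun p hp => (hV hp).1, fun p hp => (hV hp).2, hVo, hVc⟩
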